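/- **Theorem (Lower semicontinuity).** Let $n\ge 1$, $1<p<\infty$, $0<s<1$, $\Lambda\ge 1$, let $\Omega\subset\mathbb{R}^n$ be a bounded domain (a nonempty connected open set), and let $K:\mathbb{R}^n\times\mathbb{R}^n\to\mathbb{R}$ be a measurable symmetric kernel with $$\frac{\Lambda^{-1}}{|x-y|^{n+ps}}\le K(x,y)\le\frac{\Lambda}{|x-y|^{n+ps}}\qquad (x\ne y).$$ Let $u:\mathbb{R}^n\to\mathbb{R}$ be a weak supersolution of $$-\Delta_p u+\mathrm{P.V.}\int_{\mathbb{R}^n}|u(x)-u(y)|^{p-2}(u(x)-u(y))K(x,y)\,dy=0\quad\text{in }\Omega,$$ that is, $u\in L^\infty(\mathbb{R}^n)\cap W^{1,p}_{\mathrm{loc}}(\Omega)$ and, for every open $\Omega'$ whose closure is a compact subset of $\Omega$ and every nonnegative $\phi\in W^{1,p}_0(\Omega')$ (extended by zero outside $\Omega'$), $$\int_{\Omega'}|\nabla u|^{p-2}\nabla u\cdot\nabla\phi\,dx+\int_{\mathbb{R}^n}\int_{\mathbb{R}^n}|u(x)-u(y)|^{p-2}(u(x)-u(y))(\phi(x)-\phi(y))K(x,y)\,dx\,dy\ge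 0.$$ Then, for every $x\in\Omega$, the limit $$u_*(x)=\lim_{r\to0}\operatorname*{ess\,inf}_{B_r(x)}u$$ exists and is finite, and $u(x)=u_*(x)$ for every Lebesgue point $x$ of $u$ in $\Omega$, that is, for every $x\in\Omega$ with $$\lim_{r\to0}\frac{1}{|B_r(x)|}\int_{B_r(x)}|u(x)-u(y)|\,dy=0.$$ In particular, $u_*$ is a lower semicontinuous representative of $u$ in $\Omega$: $u_*$ is lower semicontinuous in $\Omega$ and $u_*=u$ almost everywhere in $\Omega$. -/

import Mathlib

open MeasureTheory Filter Topology TopologicalSpace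
open scoped Distributions Gradient

namespace MixedPLaplace

/-- `G` is the weak gradient of `u` in the open set `Ω`: both are locally integrable in `Ω` and
`∫_Ω u ∇ψ = - ∫_Ω ψ G` for all `ψ ∈ C_c^∞(Ω)`. -/
structure IsWeakGradient {n : ℕ} (Ω : Opens (EuclideanSpace ℝ (Fin n)))
    (u : EuclideanSpace ℝ (Fin n) → ℝ)
    (G : EuclideanSpace ℝ (Fin n) → EuclideanSpace ℝ (Fin n)) : Prop where
  locallyIntegrableOn : LocallyIntegrableOn u Ω
  locallyIntegrableOn_grad : LocallyIntegrableOn G Ω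
  integral_eq : ∀ ψ : 𝓓(Ω, ℝ),
    ∫ x in (Ω : Set (EuclideanSpace ℝ (Fin n))), u x • ∇ ψ x =
      - ∫ x in (Ω : Set (EuclideanSpace ℝ (Fin n))), ψ x • G x

/-- The Sobolev space `W^{1,p}(Ω)`. -/
def MemSobolev {n : ℕ} (p : ℝ) (Ω : Opens (EuclideanSpace ℝ (Fin n)))
    (u : EuclideanSpace ℝ (Fin n) → ℝ) : Prop :=
  MemLp u (ENNReal.ofReal p) (volume.restrict Ω) ∧
    ∃ G : EuclideanSpace ℝ (Fin n) → EuclideanSpace ℝ (Fin n),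
      IsWeakGradient Ω u G ∧ MemLp G (ENNReal.ofReal p) (volume.restrict Ω)

/-- `Ω' ⋐ Ω`: the closure of `Ω'` is a compact subset of `Ω`. -/
def CompactlyContained {n : ℕ} (Ω' Ω : Opens (EuclideanSpace ℝ (Fin n))) : Prop :=
  IsCompact (closure (Ω' : Set (EuclideanSpace ℝ (Fin n)))) ∧
    closure (Ω' : Set (EuclideanSpace ℝ (Fin n))) ⊆ Ω

/-- The local Sobolev space `W^{1,p}_loc(Ω)`. -/
def MemSobolevLoc {n : ℕ} (p : ℝ) (Ω : Opens (EuclideanSpace ℝ (Fin n)))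
    (u : EuclideanSpace ℝ (Fin n) → ℝ) : Prop :=
  ∀ Ω' : Opens (EuclideanSpace ℝ (Fin n)), CompactlyContained Ω' Ω → MemSobolev p Ω' u

/-- The Sobolev space with zero boundary values `W^{1,p}_0(Ω)`, the closure of `C_c^∞(Ω)` in
`W^{1,p}(Ω)`. Its elements are extended by zero to the complement of `Ω`. -/
def MemSobolevZero {n : ℕ} (p : ℝ) (Ω : Opens (EuclideanSpace ℝ (Fin n)))
    (φ : EuclideanSpace ℝ (Fin n) → ℝ) : Prop :=
  (∀ x, x ∉ Ω → φ x = 0) ∧ MemLp φ (ENNReal.ofReal p) (volume.restrict Ω) ∧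
    ∃ Φ : EuclideanSpace ℝ (Fin n) → EuclideanSpace ℝ (Fin n),
      IsWeakGradient Ω φ Φ ∧ MemLp Φ (ENNReal.ofReal p) (volume.restrict Ω) ∧
      ∃ ψ : ℕ → 𝓓(Ω, ℝ),
        Tendsto (fun k => eLpNorm (fun x => ψ k x - φ x) (ENNReal.ofReal p)
          (volume.restrict Ω)) atTop (𝓝 0) ∧
        Tendsto (fun k => eLpNorm (fun x => ∇ (ψ k) x - Φ x) (ENNReal.ofReal p)
          (volume.restrict Ω)) atTop (𝓝 0)

/-- A measurable symmetric kernel comparable to `|x - y|^{-(n + ps)}` with constant `L`. -/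
structure IsKernel {n : ℕ} (p s L : ℝ)
    (K : EuclideanSpace ℝ (Fin n) → EuclideanSpace ℝ (Fin n) → ℝ) : Prop where
  aemeasurable : AEMeasurable (Function.uncurry K) (volume.prod volume)
  symm : ∀ x y, K x y = K y x
  lower : ∀ x y, x ≠ y → L⁻¹ / ‖x - y‖ ^ ((n : ℝ) + p * s) ≤ K x y
  upper : ∀ x y, x ≠ y → K x y ≤ L / ‖x - y‖ ^ ((n : ℝ) + p * s)

/-- Weak supersolutions of `-Δ_p u + 𝓛 u = 0` in `Ω`, where `𝓛` is the nonlocal `p`-Laplace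
operator with kernel `K`. The weak gradients `G` of `u` and `Φ` of `φ` in `Ω'` exist and are unique
up to null sets, so that it does not matter which ones are taken. -/
structure IsWeakSupersolution {n : ℕ} (p : ℝ)
    (K : EuclideanSpace ℝ (Fin n) → EuclideanSpace ℝ (Fin n) → ℝ)
    (Ω : Opens (EuclideanSpace ℝ (Fin n))) (u : EuclideanSpace ℝ (Fin n) → ℝ) : Prop where
  memLp_top : MemLp u ⊤ volume
  memSobolevLoc : MemSobolevLoc p Ω u
  nonneg : ∀ Ω' : Opens (EuclideanSpace ℝ (Fin n)), CompactlyContained Ω' Ω →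
    ∀ G : EuclideanSpace ℝ (Fin n) → EuclideanSpace ℝ (Fin n), IsWeakGradient Ω' u G →
    ∀ φ : EuclideanSpace ℝ (Fin n) → ℝ, MemSobolevZero p Ω' φ → (∀ x, 0 ≤ φ x) →
    ∀ Φ : EuclideanSpace ℝ (Fin n) → EuclideanSpace ℝ (Fin n), IsWeakGradient Ω' φ Φ →
      0 ≤ (∫ x in (Ω' : Set (EuclideanSpace ℝ (Fin n))),
            ‖G x‖ ^ (p - 2) * inner ℝ (G x) (Φ x)) +
          ∫ z : EuclideanSpace ℝ (Fin n) × EuclideanSpace ℝ (Fin n),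
            |u z.1 - u z.2| ^ (p - 2) * (u z.1 - u z.2) * (φ z.1 - φ z.2) * K z.1 z.2
              ∂(volume.prod volume)

/-- The set of Lebesgue points of `u` in `Ω`. -/
def lebesguePoints {n : ℕ} (Ω : Opens (EuclideanSpace ℝ (Fin n)))
    (u : EuclideanSpace ℝ (Fin n) → ℝ) : Set (EuclideanSpace ℝ (Fin n)) :=
  {x | x ∈ Ω ∧ Tendsto (fun r : ℝ => ⨍ y in Metric.ball x r, |u x - u y|) (𝓝[>] 0) (𝓝 0)}

/-- The essential infimum of `u` over the ball `B_r(x)`. -/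
noncomputable def essInfBall {n : ℕ} (u : EuclideanSpace ℝ (Fin n) → ℝ)
    (x : EuclideanSpace ℝ (Fin n)) (r : ℝ) : ℝ :=
  essInf u (volume.restrict (Metric.ball x r))

/-- The lower semicontinuous regularization `u_*(x) = lim_{r → 0} ess inf_{B_r(x)} u`. -/
noncomputable def lscReg {n : ℕ} (u : EuclideanSpace ℝ (Fin n) → ℝ)
    (x : EuclideanSpace ℝ (Fin n)) : ℝ :=
  limUnder (𝓝[>] (0 : ℝ)) (essInfBall u x)

end MixedPLaplace

/-! Only one inequality uses the equation. If `c` lies strictly between `u x` and `lscReg u x`, then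
`u > c` almost everywhere near `x`, and the means of `|u x - u|` cannot tend to zero; so `lscReg u x
≤ u x` at Lebesgue points for every bounded `u` (`lscReg_le_of_mem_lebesguePoints`).

For the reverse inequality (`IsWeakSupersolution.le_lscReg`), suppose `u x` exceeds `lscReg u x`,
and let `d` be a third of the gap. At a Lebesgue point the density of `{u < u x - d}` in `ball x r`
tends to zero. De Giorgi's lemma (`exists_deGiorgi`) has a density threshold independent of `r`, so
for some small `r` it gives `u ≥ u x - 2d` almost everywhere in the half ball. The regularization is
then at least `u x - 2d`, which is impossible.

De Giorgi's lemma rests on an energy estimate (`exists_energy_le`). The supersolution is tested with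
`F(u) ζ^(m+1)`, where `F` is a smooth convex version of `(k - u)_+` and `ζ` is a cutoff with
gradient bounded by `N`. In both the local and the nonlocal part, convexity of `F` and Young's
inequality absorb the derivatives of the cutoff, leaving a multiple of `N^p |A|` with `A = {u < k, ζ
> 0}`. The nonlocal part is no worse than the local one because `min(1,|z|)^p / |z|^(n+ps)` is
integrable and `u` is bounded on the whole space, so no tail term is needed. Sobolev's inequality
from `W^{1,1}`, combined with Hölder on `A`, turns this into a bound of `∫ F(u) ζ^(m+1)` by a
multiple of `N |A|^(1+1/n)`. The superlinear power drives the iteration over shrinking balls and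
decreasing levels.

Smooth truncations make the chain rule and membership in `W^{1,p}_0` direct consequences of
mollification. -/

namespace MixedPLaplace
open Metric Set
open scoped ENNReal Convolution

/-! ### Mollification in `L^p`. -/

section Mollification

variable {E F : Type*} [NormedAddCommGroup E] [NormedSpace ℝ E] [FiniteDimensional ℝ E]
  [MeasurableSpace E] [BorelSpace E] [NormedAddCommGroup F] [NormedSpace ℝ F]
  {μ : Measure E} [μ.IsAddHaarMeasure]

open ContinuousLinearMap in
/-- Convolution with a normalized bump function does not increase the `L^p` norm. -/
theorem eLpNorm_normed_convolution_le (φ : ContDiffBump (0 : E)) {p : ℝ} (hp : 1 < p) {f : E → F}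
    (hf : AEStronglyMeasurable f μ) :
    eLpNorm (φ.normed μ ⋆[lsmul ℝ ℝ, μ] f) (ENNReal.ofReal p) μ ≤
      eLpNorm f (ENNReal.ofReal p) μ := by
  have hp0 : 0 < p := by linarith
  have hne0 : ENNReal.ofReal p ≠ 0 := by simpa using hp0
  rw [eLpNorm_eq_lintegral_rpow_enorm_toReal hne0 ENNReal.ofReal_ne_top,
    eLpNorm_eq_lintegral_rpow_enorm_toReal hne0 ENNReal.ofReal_ne_top, ENNReal.toReal_ofReal hp0.le]
  gcongr ?_ ^ _
  have hθm : Measurable fun t => ‖φ.normed μ t‖ₑ := φ.continuous_normed.measurable.enorm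
  have hθ1 : ∫⁻ t, ‖φ.normed μ t‖ₑ ∂μ = 1 := by
    have h := φ.integral_normed (μ := μ)
    have h2 := ofReal_integral_eq_lintegral_ofReal (φ.integrable_normed (μ := μ))
      (Eventually.of_forall φ.nonneg_normed)
    rw [h, ENNReal.ofReal_one] at h2
    rw [h2]
    refine lintegral_congr fun t => ?_
    rw [Real.enorm_of_nonneg (φ.nonneg_normed t)]
  have hmeas : AEMeasurable (fun z : E × E => ‖f (z.1 - z.2)‖ₑ) (μ.prod μ) :=
    (hf.comp_quasiMeasurePreserving
      (quasiMeasurePreserving_sub_of_right_invariant μ μ)).enorm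
  have hpt : ∀ x, ‖(φ.normed μ ⋆[lsmul ℝ ℝ, μ] f) x‖ₑ ^ p ≤
      ∫⁻ t, ‖φ.normed μ t‖ₑ * ‖f (x - t)‖ₑ ^ p ∂μ := by
    intro x
    have hfx : AEMeasurable (fun t => ‖f (x - t)‖ₑ) μ :=
      (hf.comp_quasiMeasurePreserving (quasiMeasurePreserving_sub_left μ x)).enorm
    have h1 : ‖(φ.normed μ ⋆[lsmul ℝ ℝ, μ] f) x‖ₑ ≤
        ∫⁻ t, ‖φ.normed μ t‖ₑ * ‖f (x - t)‖ₑ ∂μ := by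
      refine (enorm_integral_le_lintegral_enorm _).trans (le_of_eq ?_)
      refine lintegral_congr fun t => ?_
      rw [lsmul_apply, enorm_smul]
    -- Jensen's inequality, obtained as Hölder against the constant `1` for the probability measure
    -- whose density is the bump.
    have h2 := ENNReal.lintegral_mul_le_Lp_mul_Lq
      (μ.withDensity fun t => ‖φ.normed μ t‖ₑ) (Real.HolderConjugate.conjExponent hp)
      (f := fun t => ‖f (x - t)‖ₑ) (g := fun _ => 1)
      (hfx.mono_ac (withDensity_absolutelyContinuous _ _)) aemeasurable_const
    simp only [Pi.mul_def, mul_one, ENNReal.one_rpow, lintegral_const, one_mul] at h2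
    rw [withDensity_apply _ MeasurableSet.univ, Measure.restrict_univ, hθ1, ENNReal.one_rpow,
      mul_one, lintegral_withDensity_eq_lintegral_mul₀' hθm.aemeasurable (hfx.mono_ac
        (withDensity_absolutelyContinuous _ _)),
      lintegral_withDensity_eq_lintegral_mul₀' hθm.aemeasurable ((hfx.pow_const p).mono_ac
        (withDensity_absolutelyContinuous _ _))] at h2
    calc ‖(φ.normed μ ⋆[lsmul ℝ ℝ, μ] f) x‖ₑ ^ p
        ≤ ((∫⁻ t, ‖φ.normed μ t‖ₑ * ‖f (x - t)‖ₑ ^ p ∂μ) ^ (1 / p)) ^ p := by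
          gcongr
          exact h1.trans h2
      _ = _ := by
          rw [← ENNReal.rpow_mul, one_div, inv_mul_cancel₀ hp0.ne', ENNReal.rpow_one]
  calc ∫⁻ x, ‖(φ.normed μ ⋆[lsmul ℝ ℝ, μ] f) x‖ₑ ^ p ∂μ
      ≤ ∫⁻ x, ∫⁻ t, ‖φ.normed μ t‖ₑ * ‖f (x - t)‖ₑ ^ p ∂μ ∂μ := lintegral_mono hpt
    _ = ∫⁻ t, ∫⁻ x, ‖φ.normed μ t‖ₑ * ‖f (x - t)‖ₑ ^ p ∂μ ∂μ := by
        refine lintegral_lintegral_swap ?_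
        exact (hθm.comp measurable_snd).aemeasurable.mul (hmeas.pow_const p)
    _ = ∫⁻ t, ‖φ.normed μ t‖ₑ * ∫⁻ x, ‖f x‖ₑ ^ p ∂μ ∂μ := by
        refine lintegral_congr fun t => ?_
        rw [lintegral_const_mul' _ _ enorm_ne_top,
          lintegral_sub_right_eq_self (fun x => ‖f x‖ₑ ^ p) t]
    _ = ∫⁻ x, ‖f x‖ₑ ^ p ∂μ := by
        rw [lintegral_mul_const _ hθm, hθ1, one_mul]

open ContinuousLinearMap in
/-- Mollifications of a function in `L^p` converge to it in `L^p`. -/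
theorem tendsto_eLpNorm_normed_convolution_sub (φ : ℕ → ContDiffBump (0 : E))
    [CompleteSpace F] (hφ : Tendsto (fun k => (φ k).rOut) atTop (𝓝 0)) {p : ℝ} (hp : 1 < p)
    {f : E → F}
    (hf : MemLp f (ENNReal.ofReal p) μ) :
    Tendsto (fun k => eLpNorm ((φ k).normed μ ⋆[lsmul ℝ ℝ, μ] f - f) (ENNReal.ofReal p) μ)
      atTop (𝓝 0) := by
  have hp0 : 0 < p := by linarith
  have hp1 : 1 ≤ ENNReal.ofReal p := by
    rw [← ENNReal.ofReal_one]; exact ENNReal.ofReal_le_ofReal hp.le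
  rw [ENNReal.tendsto_atTop_zero]
  intro ε hε
  obtain ⟨δ, hδ0, hδε⟩ : ∃ δ : ℝ≥0∞, 0 < δ ∧ δ + δ + δ ≤ ε := by
    refine ⟨ε / 3, ENNReal.div_pos hε.ne' (by simp), ?_⟩
    rw [ENNReal.add_thirds]
  obtain ⟨g, hgc, hfg, hg, hgp⟩ :=
    hf.exists_hasCompactSupport_eLpNorm_sub_le ENNReal.ofReal_ne_top hδ0.ne'
  -- For radii below `1`, every mollification of `g` is supported in this fixed set of finite
  -- measure, so a small uniform error is also small in `L^p`.
  set S : Set E := cthickening 1 (tsupport g) with hS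
  have hScpt : IsCompact S := hgc.isCompact.cthickening
  have hSfin : μ S < ∞ := hScpt.measure_lt_top
  obtain ⟨τ, hτ0, hτ⟩ : ∃ τ : ℝ, 0 < τ ∧ μ S ^ (1 / p) * ENNReal.ofReal τ ≤ δ := by
    have : Tendsto (fun τ : ℝ => μ S ^ (1 / p) * ENNReal.ofReal τ) (𝓝[>] 0) (𝓝 0) := by
      have h0 : Tendsto (fun τ : ℝ => ENNReal.ofReal τ) (𝓝[>] 0) (𝓝 0) := by
        have := (ENNReal.continuous_ofReal.tendsto 0).mono_left
          (nhdsWithin_le_nhds (s := Ioi (0 : ℝ)))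
        simpa using this
      simpa using ENNReal.Tendsto.const_mul h0
        (Or.inr (ENNReal.rpow_ne_top_of_nonneg (by positivity) hSfin.ne))
    obtain ⟨τ, h1, h2⟩ := ((this.eventually (ge_mem_nhds hδ0)).and self_mem_nhdsWithin).exists
    exact ⟨τ, h2, h1⟩
  have huc := hgc.uniformContinuous_of_continuous hg
  obtain ⟨r, hr0, hr⟩ := Metric.uniformContinuous_iff.1 huc τ hτ0
  have hev : ∀ᶠ k in atTop, (φ k).rOut < min r 1 :=
    hφ.eventually (gt_mem_nhds (lt_min hr0 one_pos))
  obtain ⟨N, hN⟩ := eventually_atTop.1 hev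
  refine ⟨N, fun k hk => ?_⟩
  have hk1 := hN k hk
  have hce : ∀ h : E → F, LocallyIntegrable h μ →
      ConvolutionExists ((φ k).normed μ) h (lsmul ℝ ℝ) μ := fun h hh =>
    (φ k).hasCompactSupport_normed.convolutionExists_left _ (φ k).continuous_normed hh
  have hfl : LocallyIntegrable f μ := hf.locallyIntegrable hp1
  have hgl : LocallyIntegrable g μ := hg.locallyIntegrable
  have hsplit : (φ k).normed μ ⋆[lsmul ℝ ℝ, μ] f - f =
      ((φ k).normed μ ⋆[lsmul ℝ ℝ, μ] (f - g)) +
        (((φ k).normed μ ⋆[lsmul ℝ ℝ, μ] g - g) + (g - f)) := by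
    have h1 : f = (f - g) + g := by simp
    have h2 : (φ k).normed μ ⋆[lsmul ℝ ℝ, μ] f =
      ((φ k).normed μ ⋆[lsmul ℝ ℝ, μ] (f - g)) + ((φ k).normed μ ⋆[lsmul ℝ ℝ, μ] g) := by
      conv_lhs => rw [h1]
      exact ConvolutionExists.distrib_add (hce _ (hfl.sub hgl)) (hce _ hgl)
    rw [h2]; abel
  have hcm : ∀ h : E → F, LocallyIntegrable h μ →
      AEStronglyMeasurable ((φ k).normed μ ⋆[lsmul ℝ ℝ, μ] h) μ := fun h hh =>
    ((φ k).hasCompactSupport_normed.continuous_convolution_left _ (φ k).continuous_normed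
      hh).aestronglyMeasurable
  rw [hsplit]
  have hmid : eLpNorm ((φ k).normed μ ⋆[lsmul ℝ ℝ, μ] g - g) (ENNReal.ofReal p) μ ≤ δ := by
    have hsupp : Function.support ((φ k).normed μ ⋆[lsmul ℝ ℝ, μ] g - g) ⊆ S := by
      intro x hx
      by_contra hxS
      apply hx
      have hgx : ∀ y ∈ ball x (φ k).rOut, g y = 0 := by
        intro y hy
        by_contra hy0
        apply hxS
        refine mem_cthickening_of_dist_le x y 1 _ (subset_tsupport g hy0) ?_
        rw [dist_comm]
        exact (hy.le).trans ((hk1.le).trans (min_le_right _ _))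
      have hgx0 : g x = 0 := hgx x (mem_ball_self (φ k).rOut_pos)
      have := (φ k).normed_convolution_eq_right (μ := μ) (g := g) (x₀ := x)
        (fun y hy => by rw [hgx y hy, hgx0])
      simp [this]
    have hbd : ∀ x, ‖((φ k).normed μ ⋆[lsmul ℝ ℝ, μ] g - g) x‖ ≤ τ := by
      intro x
      rw [Pi.sub_apply, ← dist_eq_norm]
      refine (φ k).dist_normed_convolution_le hg.aestronglyMeasurable fun y hy => ?_
      exact (hr ((mem_ball.1 hy).trans_le ((hk1.le).trans (min_le_left _ _)))).le
    rw [← eLpNorm_restrict_eq_of_support_subset hsupp]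
    refine (eLpNorm_le_of_ae_bound (Eventually.of_forall hbd)).trans ?_
    simpa [ENNReal.toReal_ofReal hp0.le] using hτ
  calc _ ≤ eLpNorm ((φ k).normed μ ⋆[lsmul ℝ ℝ, μ] (f - g)) (ENNReal.ofReal p) μ +
        (eLpNorm ((φ k).normed μ ⋆[lsmul ℝ ℝ, μ] g - g) (ENNReal.ofReal p) μ +
          eLpNorm (g - f) (ENNReal.ofReal p) μ) := by
        refine (eLpNorm_add_le (hcm _ (hfl.sub hgl)) (((hcm _ hgl).sub
          hg.aestronglyMeasurable).add (hg.aestronglyMeasurable.sub hf.1)) hp1).trans ?_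
        gcongr
        exact eLpNorm_add_le ((hcm _ hgl).sub hg.aestronglyMeasurable)
          (hg.aestronglyMeasurable.sub hf.1) hp1
    _ ≤ δ + (δ + δ) := by
        gcongr
        · exact (eLpNorm_normed_convolution_le (φ k) hp (hf.1.sub hg.aestronglyMeasurable)).trans hfg
        · rw [eLpNorm_sub_comm]; exact hfg
    _ ≤ ε := by rw [← add_assoc]; exact hδε

end Mollification

/-! ### Dominated convergence for `L^p` norms. -/

section DominatedConvergence

/-- Dominated convergence in `L^p`. -/
theorem tendsto_eLpNorm_zero_of_dominated {α F : Type*} [MeasurableSpace α] {μ : Measure α}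
    [NormedAddCommGroup F] {p : ℝ} (hp : 0 < p) {f : ℕ → α → F} {g : α → ℝ}
    (hf : ∀ k, AEStronglyMeasurable (f k) μ) (hg : MemLp g (ENNReal.ofReal p) μ)
    (hbound : ∀ k, ∀ᵐ x ∂μ, ‖f k x‖ ≤ ‖g x‖)
    (hlim : ∀ᵐ x ∂μ, Tendsto (fun k => f k x) atTop (𝓝 0)) :
    Tendsto (fun k => eLpNorm (f k) (ENNReal.ofReal p) μ) atTop (𝓝 0) := by
  have hne0 : ENNReal.ofReal p ≠ 0 := by simpa using hp
  simp only [eLpNorm_eq_lintegral_rpow_enorm_toReal hne0 ENNReal.ofReal_ne_top,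
    ENNReal.toReal_ofReal hp.le]
  have h0 : Tendsto (fun k => ∫⁻ x, ‖f k x‖ₑ ^ p ∂μ) atTop (𝓝 (∫⁻ _, 0 ∂μ)) := by
    refine tendsto_lintegral_of_dominated_convergence' (fun x => ‖g x‖ₑ ^ p)
      (fun k => (hf k).enorm.pow_const p) (fun k => ?_) ?_ ?_
    · filter_upwards [hbound k] with x hx
      gcongr
      exact enorm_le_iff_norm_le.2 hx
    · have := lintegral_rpow_enorm_lt_top_of_eLpNorm_lt_top hne0 ENNReal.ofReal_ne_top hg.2
      rw [ENNReal.toReal_ofReal hp.le] at this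
      exact this.ne
    · filter_upwards [hlim] with x hx
      have h1 : Tendsto (fun k => ‖f k x‖ₑ) atTop (𝓝 0) := by simpa using hx.enorm
      have h2 := ((ENNReal.continuous_rpow_const (y := p)).tendsto 0).comp h1
      simpa [ENNReal.zero_rpow_of_pos hp, Function.comp_def] using h2
  have h2 := ((ENNReal.continuous_rpow_const (y := 1 / p)).tendsto 0).comp
    (by simpa using h0 : Tendsto (fun k => ∫⁻ x, ‖f k x‖ₑ ^ p ∂μ) atTop (𝓝 0))
  simpa [ENNReal.zero_rpow_of_pos (inv_pos.2 hp), Function.comp_def] using h2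

end DominatedConvergence

/-! ### Weak gradients, and approximation by test functions in `W^{1,p}_0`. -/

section WeakGradient

variable {n : ℕ}

local notation "E" => EuclideanSpace ℝ (Fin n)

theorem norm_gradient {f : E → ℝ} (x : E) : ‖∇ f x‖ = ‖fderiv ℝ f x‖ := by
  simp [gradient]

theorem continuous_gradient {f : E → ℝ} (hf : ContDiff ℝ 1 f) : Continuous (∇ f) :=
  (InnerProductSpace.toDual ℝ E).symm.continuous.comp (hf.continuous_fderiv one_ne_zero)

theorem gradient_eq_zero_of_notMem_tsupport {f : E → ℝ} {x : E} (hx : x ∉ tsupport f) :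
    ∇ f x = 0 := by
  have : fderiv ℝ f x = 0 := by
    by_contra h
    exact hx (support_fderiv_subset ℝ h)
  simp [gradient, this]

theorem hasCompactSupport_gradient {f : E → ℝ} (hf : HasCompactSupport f) :
    HasCompactSupport (∇ f) :=
  HasCompactSupport.intro hf fun _ hx => gradient_eq_zero_of_notMem_tsupport hx

theorem TestFunction.contDiff_one {Ω : Opens E} (ψ : 𝓓(Ω, ℝ)) : ContDiff ℝ 1 ψ :=
  ψ.contDiff.of_le (by exact_mod_cast le_top)

theorem TestFunction.continuous_grad {Ω : Opens E} (ψ : 𝓓(Ω, ℝ)) : Continuous (∇ ψ) :=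
  continuous_gradient (TestFunction.contDiff_one ψ)

/-- The classical gradient of a test function is a weak gradient. -/
theorem TestFunction.integral_smul_gradient {Ω : Opens E} (ψ χ : 𝓓(Ω, ℝ)) :
    ∫ x in (Ω : Set E), ψ x • ∇ χ x = - ∫ x in (Ω : Set E), χ x • ∇ ψ x := by
  have hout : ∀ (a b : 𝓓(Ω, ℝ)), ∫ x in (Ω : Set E), a x • ∇ b x = ∫ x, a x • ∇ b x := by
    intro a b
    refine setIntegral_eq_integral_of_forall_compl_eq_zero fun x hx => ?_
    rw [image_eq_zero_of_notMem_tsupport fun h => hx (a.tsupport_subset h), zero_smul]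
  have hint : ∀ (a b : 𝓓(Ω, ℝ)), Integrable (fun x => a x • ∇ b x) := fun a b =>
    (a.continuous.smul (TestFunction.continuous_grad b)).integrable_of_hasCompactSupport
      a.hasCompactSupport.smul_right
  have hint' : ∀ (a b : 𝓓(Ω, ℝ)) (e : E), Integrable (fun x => a x * fderiv ℝ b x e) := by
    intro a b e
    refine ((hint a b).const_inner e).congr (Eventually.of_forall fun x => ?_)
    simp [inner_smul_right, inner_gradient_right]
  rw [hout, hout]
  refine ext_inner_left ℝ fun e => ?_
  rw [inner_neg_right, ← integral_inner (hint ψ χ), ← integral_inner (hint χ ψ)]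
  simp only [inner_smul_right, inner_gradient_right, conj_trivial]
  have h := integral_mul_fderiv_eq_neg_fderiv_mul_of_integrable (μ := volume) (f := ψ) (g := χ)
    (v := e) (by simpa only [mul_comm] using hint' χ ψ e) (hint' ψ χ e)
    ((ψ.continuous.mul χ.continuous).integrable_of_hasCompactSupport
      ψ.hasCompactSupport.mul_right)
    (fun x _ => (TestFunction.contDiff_one ψ).differentiable one_ne_zero x)
    (fun x _ => (TestFunction.contDiff_one χ).differentiable one_ne_zero x)
  simpa [mul_comm] using h

theorem locallyIntegrableOn_of_memLp {α F : Type*} [TopologicalSpace α] [MeasurableSpace α]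
    [NormedAddCommGroup F] {μ : Measure α} [IsLocallyFiniteMeasure μ] {f : α → F} {q : ℝ≥0∞}
    (hq : 1 ≤ q) {s : Set α} (hs : MeasurableSet s) (hf : MemLp f q (μ.restrict s)) :
    LocallyIntegrableOn f s μ :=
  ((((memLp_indicator_iff_restrict hs).2 hf).locallyIntegrable hq).locallyIntegrableOn s).congr
    (indicator_ae_eq_restrict hs)

/-- Limits in `L^p` of test functions whose gradients converge in `L^p` have a weak gradient. -/
theorem isWeakGradient_of_tendsto {p : ℝ} (hp : 1 < p) {Ω : Opens E} {φ : E → ℝ} {Φ : E → E}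
    (hφ : MemLp φ (ENNReal.ofReal p) (volume.restrict Ω))
    (hΦ : MemLp Φ (ENNReal.ofReal p) (volume.restrict Ω)) {ψ : ℕ → 𝓓(Ω, ℝ)}
    (h1 : Tendsto (fun k => eLpNorm (fun x => ψ k x - φ x) (ENNReal.ofReal p)
          (volume.restrict Ω)) atTop (𝓝 0))
    (h2 : Tendsto (fun k => eLpNorm (fun x => ∇ (ψ k) x - Φ x) (ENNReal.ofReal p)
          (volume.restrict Ω)) atTop (𝓝 0)) :
    IsWeakGradient Ω φ Φ := by
  have hp1 : 1 ≤ ENNReal.ofReal p := by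
    rw [← ENNReal.ofReal_one]; exact ENNReal.ofReal_le_ofReal hp.le
  refine ⟨locallyIntegrableOn_of_memLp hp1 Ω.isOpen.measurableSet hφ,
    locallyIntegrableOn_of_memLp hp1 Ω.isOpen.measurableSet hΦ, fun χ => ?_⟩
  -- Integration by parts holds for each test function of the sequence. Both sides pass to the limit
  -- because `χ` and its gradient lie in the dual space `L^q`.
  have hq : ENNReal.HolderTriple (ENNReal.ofReal p.conjExponent) (ENNReal.ofReal p) 1 :=
    (Real.HolderConjugate.conjExponent hp).symm.ennrealOfReal
  set q := ENNReal.ofReal p.conjExponent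
  have hχ : MemLp χ q (volume.restrict Ω) :=
    (χ.continuous.memLp_of_hasCompactSupport χ.hasCompactSupport).restrict _
  have hχ' : MemLp (∇ χ) q (volume.restrict Ω) :=
    ((TestFunction.continuous_grad χ).memLp_of_hasCompactSupport
      (hasCompactSupport_gradient χ.hasCompactSupport)).restrict _
  have hψ : ∀ k, MemLp (ψ k) (ENNReal.ofReal p) (volume.restrict Ω) := fun k =>
    ((ψ k).continuous.memLp_of_hasCompactSupport (ψ k).hasCompactSupport).restrict _
  have hψ' : ∀ k, MemLp (∇ (ψ k)) (ENNReal.ofReal p) (volume.restrict Ω) := fun k =>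
    ((TestFunction.continuous_grad (ψ k)).memLp_of_hasCompactSupport
      (hasCompactSupport_gradient (ψ k).hasCompactSupport)).restrict _
  have hl1 : Tendsto (fun k => ∫ x in (Ω : Set E), ψ k x • ∇ χ x) atTop
      (𝓝 (∫ x in (Ω : Set E), φ x • ∇ χ x)) := by
    refine tendsto_integral_of_L1' _ (hφ.1.smul hχ'.1)
      (Eventually.of_forall fun k => memLp_one_iff_integrable.1 (hχ'.smul (hψ k))) ?_
    have hb : ∀ k, eLpNorm ((fun x => ψ k x • ∇ χ x) - fun x => φ x • ∇ χ x) 1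
        (volume.restrict Ω) ≤ eLpNorm (fun x => ψ k x - φ x) (ENNReal.ofReal p)
          (volume.restrict Ω) * eLpNorm (∇ χ) q (volume.restrict Ω) := by
      intro k
      have : ((fun x => ψ k x • ∇ χ x) - fun x => φ x • ∇ χ x) =
          (fun x => ψ k x - φ x) • ∇ χ := by
        ext1 x; simp [sub_smul]
      rw [this]
      exact eLpNorm_smul_le_mul_eLpNorm hχ'.1 ((hψ k).1.sub hφ.1)
    refine tendsto_of_tendsto_of_tendsto_of_le_of_le tendsto_const_nhds ?_
      (fun _ => zero_le) hb
    simpa using ENNReal.Tendsto.mul_const h1 (Or.inr hχ'.2.ne)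
  have hl2 : Tendsto (fun k => ∫ x in (Ω : Set E), χ x • ∇ (ψ k) x) atTop
      (𝓝 (∫ x in (Ω : Set E), χ x • Φ x)) := by
    refine tendsto_integral_of_L1' _ (hχ.1.smul hΦ.1)
      (Eventually.of_forall fun k => memLp_one_iff_integrable.1 ((hψ' k).smul hχ)) ?_
    have hb : ∀ k, eLpNorm ((fun x => χ x • ∇ (ψ k) x) - fun x => χ x • Φ x) 1
        (volume.restrict Ω) ≤ eLpNorm χ q (volume.restrict Ω) *
          eLpNorm (fun x => ∇ (ψ k) x - Φ x) (ENNReal.ofReal p) (volume.restrict Ω) := by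
      intro k
      have : ((fun x => χ x • ∇ (ψ k) x) - fun x => χ x • Φ x) =
          (χ : E → ℝ) • (fun x => ∇ (ψ k) x - Φ x) := by
        ext1 x; simp [smul_sub]
      rw [this]
      exact eLpNorm_smul_le_mul_eLpNorm ((hψ' k).1.sub hΦ.1) hχ.1
    refine tendsto_of_tendsto_of_tendsto_of_le_of_le tendsto_const_nhds ?_
      (fun _ => zero_le) hb
    simpa using ENNReal.Tendsto.const_mul h2 (Or.inr hχ.2.ne)
  refine tendsto_nhds_unique hl1 ?_
  refine hl2.neg.congr fun k => ?_
  exact (TestFunction.integral_smul_gradient (ψ k) χ).symm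

open ContinuousLinearMap in
/-- The gradient of a mollification is the mollification of the weak gradient, away from the
boundary. -/
theorem IsWeakGradient.hasGradientAt_convolution {Ω : Opens E} {u : E → ℝ} {G : E → E}
    (h : IsWeakGradient Ω u G) (hu : LocallyIntegrable ((Ω : Set E).indicator u))
    (φ : ContDiffBump (0 : E)) {x : E} (hx : closedBall x φ.rOut ⊆ Ω) :
    HasGradientAt (φ.normed volume ⋆[lsmul ℝ ℝ, volume] (Ω : Set E).indicator u)
      ((φ.normed volume ⋆[lsmul ℝ ℝ, volume] (Ω : Set E).indicator G) x) x := by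
  have hder := φ.hasCompactSupport_normed.hasFDerivAt_convolution_left (lsmul ℝ ℝ)
    (φ.contDiff_normed (μ := volume) (n := 1)) hu x
  suffices hEq : InnerProductSpace.toDual ℝ E
      ((φ.normed volume ⋆[lsmul ℝ ℝ, volume] (Ω : Set E).indicator G) x) =
      (fderiv ℝ (φ.normed volume) ⋆[(lsmul ℝ ℝ).precompL E, volume]
        (Ω : Set E).indicator u) x by
    rw [hasGradientAt_iff_hasFDerivAt, hEq]
    exact hder
  set θ := φ.normed (volume : Measure E) with hθ
  have hθd : ContDiff ℝ ((⊤ : ℕ∞) : WithTop ℕ∞) θ := φ.contDiff_normed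
  have hsupp : tsupport (fun y => θ (x - y)) ⊆ closedBall x φ.rOut := by
    refine closure_minimal (fun y hy => ?_) isClosed_closedBall
    have : x - y ∈ Function.support θ := hy
    rw [hθ, φ.support_normed_eq] at this
    rw [mem_closedBall, dist_comm, dist_eq_norm]
    exact (mem_ball_zero_iff.1 this).le
  -- The reflected, translated bump is admissible in the definition of the weak gradient exactly
  -- because the closed ball lies in `Ω`; the sign from the reflection cancels the one from
  -- integration by parts.
  let ψ : 𝓓(Ω, ℝ) := ⟨fun y => θ (x - y), hθd.comp (contDiff_const.sub contDiff_id),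
    HasCompactSupport.of_support_subset_isCompact (isCompact_closedBall x φ.rOut)
      ((subset_tsupport _).trans hsupp), hsupp.trans hx⟩
  have hψ : ∀ y, ψ y = θ (x - y) := fun y => rfl
  have hψ' : ∀ y, fderiv ℝ ψ y = - fderiv ℝ θ (x - y) := by
    intro y
    have h1 : HasFDerivAt θ (fderiv ℝ θ (x - y)) (x - y) :=
      (hθd.differentiable (by simp) _).hasFDerivAt
    have h2 : HasFDerivAt (fun y => x - y) (-ContinuousLinearMap.id ℝ E) y :=
      (hasFDerivAt_id y).const_sub x
    have h3 := (h1.comp y h2).fderiv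
    rw [comp_neg, comp_id] at h3
    exact h3
  rw [convolution_eq_swap, convolution_eq_swap]
  have e1 : ∫ t, lsmul ℝ ℝ (θ (x - t)) ((Ω : Set E).indicator G t) =
      ∫ y in (Ω : Set E), ψ y • G y := by
    rw [← integral_indicator Ω.isOpen.measurableSet]
    refine integral_congr_ae (Eventually.of_forall fun y => ?_)
    by_cases hy : y ∈ (Ω : Set E) <;> simp [hy, hψ]
  have e2 : ∫ t, ((lsmul ℝ ℝ).precompL E (fderiv ℝ θ (x - t)))
        ((Ω : Set E).indicator u t) =
      - ∫ y in (Ω : Set E), u y • fderiv ℝ ψ y := by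
    rw [← integral_indicator Ω.isOpen.measurableSet, ← integral_neg]
    refine integral_congr_ae (Eventually.of_forall fun y => ?_)
    ext e
    by_cases hy : y ∈ (Ω : Set E) <;> simp [hy, hψ', precompL_apply, mul_comm]
  rw [e1, e2, ← neg_inj, neg_neg, ← map_neg, ← h.integral_eq ψ]
  have hcongr : ∀ {F : Type} [NormedAddCommGroup F] [NormedSpace ℝ F] (g : E → F),
      Integrable (fun y => (Ω : Set E).indicator u y • g y) →
      Integrable (fun y => u y • g y) (volume.restrict (Ω : Set E)) := by
    intro F _ _ g hg
    refine (hg.restrict (s := (Ω : Set E))).congr ?_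
    filter_upwards [ae_restrict_mem Ω.isOpen.measurableSet] with y hy
    rw [indicator_of_mem hy]
  have i1 : Integrable (fun y => u y • ∇ ψ y) (volume.restrict (Ω : Set E)) :=
    hcongr _ (hu.integrable_smul_right_of_hasCompactSupport (TestFunction.continuous_grad ψ)
      (hasCompactSupport_gradient ψ.hasCompactSupport))
  have i2 : Integrable (fun y => u y • fderiv ℝ ψ y) (volume.restrict (Ω : Set E)) :=
    hcongr _ (hu.integrable_smul_right_of_hasCompactSupport
      ((TestFunction.contDiff_one ψ).continuous_fderiv one_ne_zero)
      (ψ.hasCompactSupport.fderiv ℝ))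
  ext e
  rw [ContinuousLinearMap.integral_apply i2, InnerProductSpace.toDual_apply_apply,
    real_inner_comm, ← integral_inner i1]
  simp [inner_smul_right, inner_gradient_right]

/-- `φ` is an element of `W^{1,p}_0(Ω)` with gradient `Φ`. -/
structure HasZeroSobolevGradient (p : ℝ) (Ω : Opens E) (φ : E → ℝ) (Φ : E → E) : Prop where
  eq_zero : ∀ x, x ∉ Ω → φ x = 0
  memLp : MemLp φ (ENNReal.ofReal p) (volume.restrict Ω)
  memLp_grad : MemLp Φ (ENNReal.ofReal p) (volume.restrict Ω)
  exists_testFunction : ∃ ψ : ℕ → 𝓓(Ω, ℝ),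
    Tendsto (fun k => eLpNorm (fun x => ψ k x - φ x) (ENNReal.ofReal p)
      (volume.restrict Ω)) atTop (𝓝 0) ∧
    Tendsto (fun k => eLpNorm (fun x => ∇ (ψ k) x - Φ x) (ENNReal.ofReal p)
      (volume.restrict Ω)) atTop (𝓝 0)

theorem HasZeroSobolevGradient.isWeakGradient {p : ℝ} (hp : 1 < p) {Ω : Opens E} {φ : E → ℝ}
    {Φ : E → E} (h : HasZeroSobolevGradient p Ω φ Φ) : IsWeakGradient Ω φ Φ :=
  let ⟨_, h1, h2⟩ := h.exists_testFunction
  isWeakGradient_of_tendsto hp h.memLp h.memLp_grad h1 h2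

theorem HasZeroSobolevGradient.memSobolevZero {p : ℝ} (hp : 1 < p) {Ω : Opens E} {φ : E → ℝ}
    {Φ : E → E} (h : HasZeroSobolevGradient p Ω φ Φ) : MemSobolevZero p Ω φ :=
  ⟨h.eq_zero, h.memLp, Φ, h.isWeakGradient hp, h.memLp_grad, h.exists_testFunction⟩

set_option maxHeartbeats 400000 in
/-- A function of class `W^{1,p}`, composed with a smooth `1`-Lipschitz function and multiplied by
a cutoff function, belongs to `W^{1,p}_0`. -/
theorem hasZeroSobolevGradient_comp_mul {p : ℝ} (hp : 1 < p) {Ω : Opens E} {v : E → ℝ} {G : E → E}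
    (hvm : Measurable v)
    (hv : MemLp v (ENNReal.ofReal p) (volume.restrict Ω))
    (hG : IsWeakGradient Ω v G) (hGp : MemLp G (ENNReal.ofReal p) (volume.restrict Ω))
    {F : ℝ → ℝ} (hF : ContDiff ℝ (⊤ : ℕ∞) F) (hF' : ∀ t, |deriv F t| ≤ 1)
    {η : E → ℝ} (hη : ContDiff ℝ (⊤ : ℕ∞) η) (hηc : HasCompactSupport η) (hηΩ : tsupport η ⊆ Ω) :
    HasZeroSobolevGradient p Ω (fun x => F (v x) * η x)
      (fun x => (deriv F (v x) * η x) • G x + F (v x) • ∇ η x) := by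
  have hp0 : 0 < p := by linarith
  have hp1 : 1 ≤ ENNReal.ofReal p := by
    rw [← ENNReal.ofReal_one]; exact ENNReal.ofReal_le_ofReal hp.le
  have hΩm : MeasurableSet (Ω : Set E) := Ω.isOpen.measurableSet
  have hη1 : ContDiff ℝ 1 η := hη.of_le (by exact_mod_cast le_top)
  have hF1 : ContDiff ℝ 1 F := hF.of_le (by exact_mod_cast le_top)
  have hFd : Differentiable ℝ F := hF1.differentiable one_ne_zero
  have hF'c : Continuous (deriv F) := hF1.continuous_deriv le_rfl
  have hFlip : ∀ a b, |F a - F b| ≤ |a - b| := by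
    intro a b
    have := Convex.norm_image_sub_le_of_norm_deriv_le (f := F) (C := 1) (s := univ)
      (fun x _ => hFd x) (fun x _ => hF' x) convex_univ (mem_univ b) (mem_univ a)
    simpa using this
  have hηcont := hη.continuous
  have hη'cont := continuous_gradient hη1
  obtain ⟨C, hC⟩ := hηcont.bounded_above_of_compact_support hηc
  obtain ⟨C', hC'⟩ := hη'cont.bounded_above_of_compact_support (hasCompactSupport_gradient hηc)
  have hC0 : 0 ≤ C := (norm_nonneg _).trans (hC 0)
  have hC'0 : 0 ≤ C' := (norm_nonneg _).trans (hC' 0)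
  -- the mollifiers
  obtain ⟨δ, hδ0, hδ⟩ := hηc.isCompact.exists_cthickening_subset_open Ω.isOpen hηΩ
  -- Outer radii at most `δ` keep the balls around points of `tsupport η` inside `Ω`. The fixed
  -- ratio `2` to the inner radii is what almost everywhere convergence of the mollifications
  -- requires.
  let κ : ℕ → ContDiffBump (0 : E) := fun k =>
    ⟨δ / 2 * (1 / ((k : ℝ) + 1)), δ * (1 / ((k : ℝ) + 1)), by positivity, by
      have : 0 < 1 / ((k : ℝ) + 1) := by positivity
      nlinarith⟩
  have hκr : ∀ k, (κ k).rOut ≤ δ := by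
    intro k
    change δ * (1 / ((k : ℝ) + 1)) ≤ δ
    refine mul_le_of_le_one_right hδ0.le ?_
    rw [div_le_one (by positivity)]
    linarith [k.cast_nonneg (α := ℝ)]
  have hκ0 : Tendsto (fun k => (κ k).rOut) atTop (𝓝 0) := by
    have := (tendsto_one_div_add_atTop_nhds_zero_nat (𝕜 := ℝ)).const_mul δ
    rwa [mul_zero] at this
  have hκK : ∀ᶠ k in atTop, (κ k).rOut ≤ 2 * (κ k).rIn := by
    refine Eventually.of_forall fun k => ?_
    change δ * (1 / ((k : ℝ) + 1)) ≤ 2 * (δ / 2 * (1 / ((k : ℝ) + 1)))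
    exact le_of_eq (by ring)
  set v1 := (Ω : Set E).indicator v with hv1
  set G1 := (Ω : Set E).indicator G with hG1
  have hv1p : MemLp v1 (ENNReal.ofReal p) volume := (memLp_indicator_iff_restrict hΩm).2 hv
  have hG1p : MemLp G1 (ENNReal.ofReal p) volume := (memLp_indicator_iff_restrict hΩm).2 hGp
  have hv1l := hv1p.locallyIntegrable hp1
  have hG1l := hG1p.locallyIntegrable hp1
  let vk : ℕ → E → ℝ := fun k =>
    (κ k).normed volume ⋆[ContinuousLinearMap.lsmul ℝ ℝ, volume] v1
  let Gk : ℕ → E → E := fun k =>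
    (κ k).normed volume ⋆[ContinuousLinearMap.lsmul ℝ ℝ, volume] G1
  have hvks : ∀ k, ContDiff ℝ (⊤ : ℕ∞) (vk k) := fun k =>
    (κ k).hasCompactSupport_normed.contDiff_convolution_left _ (κ k).contDiff_normed hv1l
  have hGkc : ∀ k, Continuous (Gk k) := fun k =>
    (κ k).hasCompactSupport_normed.continuous_convolution_left _ (κ k).continuous_normed hG1l
  have hvkL : Tendsto (fun k => eLpNorm (vk k - v1) (ENNReal.ofReal p) volume) atTop (𝓝 0) :=
    tendsto_eLpNorm_normed_convolution_sub κ hκ0 hp hv1p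
  have hGkL : Tendsto (fun k => eLpNorm (Gk k - G1) (ENNReal.ofReal p) volume) atTop (𝓝 0) :=
    tendsto_eLpNorm_normed_convolution_sub κ hκ0 hp hG1p
  have hvkae : ∀ᵐ x, Tendsto (fun k => vk k x) atTop (𝓝 (v1 x)) :=
    ContDiffBump.ae_convolution_tendsto_right_of_locallyIntegrable hκ0 hκK hv1l
  have hgrad : ∀ k, ∀ x ∈ tsupport η, HasGradientAt (vk k) (Gk k x) x := by
    intro k x hx
    refine hG.hasGradientAt_convolution hv1l (κ k) (Subset.trans ?_ hδ)
    intro y hy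
    exact mem_cthickening_of_dist_le y x δ _ hx ((mem_closedBall.1 hy).trans (hκr k))
  clear_value vk Gk
  let ψ : ℕ → 𝓓(Ω, ℝ) := fun k => ⟨fun x => F (vk k x) * η x,
    (hF.comp (hvks k)).mul hη, hηc.mul_left, (tsupport_mul_subset_right).trans hηΩ⟩
  have hψ : ∀ k x, ψ k x = F (vk k x) * η x := fun k x => rfl
  have hψ' : ∀ k x, ∇ (ψ k) x = (deriv F (vk k x) * η x) • Gk k x + F (vk k x) • ∇ η x := by
    intro k x
    by_cases hx : x ∈ tsupport η
    · refine HasGradientAt.gradient ?_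
      rw [hasGradientAt_iff_hasFDerivAt]
      have h1 := (hFd (vk k x)).hasDerivAt.comp_hasFDerivAt x (hgrad k x hx).hasFDerivAt
      have h2 := (hη1.differentiable one_ne_zero x).hasGradientAt.hasFDerivAt
      refine (h1.mul h2).congr_fderiv ?_
      ext e
      simp
      ring
    · have hx' : x ∉ tsupport (ψ k) := fun h => hx (tsupport_mul_subset_right h)
      rw [gradient_eq_zero_of_notMem_tsupport hx', gradient_eq_zero_of_notMem_tsupport hx,
        image_eq_zero_of_notMem_tsupport hx]
      simp
  set Φ : E → E := fun x => (deriv F (v x) * η x) • G x + F (v x) • ∇ η x with hΦ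
  have hFvm : Measurable fun x => F (v x) := hF.continuous.measurable.comp hvm
  have hF'vm : Measurable fun x => deriv F (v x) := hF'c.measurable.comp hvm
  have hηp : MemLp η (ENNReal.ofReal p) (volume.restrict Ω) :=
    (hηcont.memLp_of_hasCompactSupport hηc).restrict _
  have hη'p : MemLp (∇ η) (ENNReal.ofReal p) (volume.restrict Ω) :=
    (hη'cont.memLp_of_hasCompactSupport (hasCompactSupport_gradient hηc)).restrict _
  have hφp : MemLp (fun x => F (v x) * η x) (ENNReal.ofReal p) (volume.restrict Ω) := by
    -- `F 0` may be nonzero: `F(v) - F(0)` is dominated by `|v|`, and `F(0) η` is bounded with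
    -- compact support.
    have h1 : MemLp (fun x => (F (v x) - F 0) * η x) (ENNReal.ofReal p) (volume.restrict Ω) := by
      refine hv.of_le_mul (c := C) ((hFvm.sub_const _).mul hηcont.measurable).aestronglyMeasurable
        (Eventually.of_forall fun x => ?_)
      rw [norm_mul, mul_comm]
      have := hFlip (v x) 0
      rw [sub_zero] at this
      exact mul_le_mul (hC x) this (norm_nonneg _) hC0
    have h2 := h1.add (hηp.const_mul (F 0))
    refine (memLp_congr_ae (Eventually.of_forall fun x => ?_)).1 h2
    simp only [Pi.add_apply]
    ring
  have hΦp : MemLp Φ (ENNReal.ofReal p) (volume.restrict Ω) := by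
    have h1 : MemLp (fun x => (F (v x) - F 0) • ∇ η x) (ENNReal.ofReal p)
        (volume.restrict Ω) := by
      refine hv.of_le_mul (c := C') ((hFvm.sub_const _).smul
        hη'cont.measurable).aestronglyMeasurable (Eventually.of_forall fun x => ?_)
      rw [norm_smul, mul_comm]
      have := hFlip (v x) 0
      rw [sub_zero] at this
      exact mul_le_mul (hC' x) this (norm_nonneg _) hC'0
    have h2 := h1.add (hη'p.const_smul (F 0))
    have h3 : MemLp (fun x => (deriv F (v x) * η x) • G x) (ENNReal.ofReal p)
        (volume.restrict Ω) := by
      refine hGp.of_le_mul (c := C) ((hF'vm.mul hηcont.measurable).aestronglyMeasurable.smul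
        hGp.1) (Eventually.of_forall fun x => ?_)
      rw [norm_smul, norm_mul]
      gcongr
      calc _ ≤ 1 * C := mul_le_mul (hF' _) (hC x) (norm_nonneg _) zero_le_one
        _ = C := one_mul C
    refine (memLp_congr_ae (Eventually.of_forall fun x => ?_)).1 (h3.add h2)
    simp only [hΦ, Pi.add_apply, Pi.smul_apply, ← add_smul, sub_add_cancel]
  have hvkΩ : Tendsto (fun k => eLpNorm (fun x => vk k x - v x) (ENNReal.ofReal p)
      (volume.restrict Ω)) atTop (𝓝 0) := by
    refine tendsto_of_tendsto_of_tendsto_of_le_of_le tendsto_const_nhds hvkL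
      (fun _ => zero_le) fun k => ?_
    refine (eLpNorm_congr_ae (g := vk k - v1) ?_).trans_le (eLpNorm_restrict_le _ _ _ _)
    filter_upwards [ae_restrict_mem hΩm] with x hx
    simp [hv1, hx]
  have hGkΩ : Tendsto (fun k => eLpNorm (fun x => Gk k x - G x) (ENNReal.ofReal p)
      (volume.restrict Ω)) atTop (𝓝 0) := by
    refine tendsto_of_tendsto_of_tendsto_of_le_of_le tendsto_const_nhds hGkL
      (fun _ => zero_le) fun k => ?_
    refine (eLpNorm_congr_ae (g := Gk k - G1) ?_).trans_le (eLpNorm_restrict_le _ _ _ _)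
    filter_upwards [ae_restrict_mem hΩm] with x hx
    simp [hG1, hx]
  have hscale : ∀ {H H' : Type} [NormedAddCommGroup H] [NormedAddCommGroup H']
      {f : ℕ → E → H} {g : ℕ → E → H'} (c : ℝ), (∀ k x, ‖f k x‖ ≤ c * ‖g k x‖) →
      Tendsto (fun k => eLpNorm (g k) (ENNReal.ofReal p) (volume.restrict Ω)) atTop (𝓝 0) →
      Tendsto (fun k => eLpNorm (f k) (ENNReal.ofReal p) (volume.restrict Ω)) atTop (𝓝 0) := by
    intro H H' _ _ f g c hfg hg
    have h0 := ENNReal.Tendsto.const_mul (a := ENNReal.ofReal c) hg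
      (Or.inr ENNReal.ofReal_ne_top)
    rw [mul_zero] at h0
    exact tendsto_of_tendsto_of_tendsto_of_le_of_le tendsto_const_nhds h0 (fun _ => zero_le)
      fun k => eLpNorm_le_mul_eLpNorm_of_ae_le_mul (Eventually.of_forall (hfg k)) _
  have hlim1 : Tendsto (fun k => eLpNorm (fun x => ψ k x - F (v x) * η x) (ENNReal.ofReal p)
      (volume.restrict Ω)) atTop (𝓝 0) := by
    refine hscale C (fun k x => ?_) hvkΩ
    rw [hψ, ← sub_mul, norm_mul, mul_comm]
    exact mul_le_mul (hC x) (hFlip _ _) (norm_nonneg _) hC0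
  have hlim2 : Tendsto (fun k => eLpNorm (fun x => ∇ (ψ k) x - Φ x) (ENNReal.ofReal p)
      (volume.restrict Ω)) atTop (𝓝 0) := by
    have ha : Tendsto (fun k => eLpNorm (fun x => (deriv F (vk k x) * η x) • (Gk k x - G x))
        (ENNReal.ofReal p) (volume.restrict Ω)) atTop (𝓝 0) := by
      refine hscale C (fun k x => ?_) hGkΩ
      rw [norm_smul, norm_mul]
      gcongr
      calc _ ≤ 1 * C := mul_le_mul (hF' _) (hC x) (norm_nonneg _) zero_le_one
        _ = C := one_mul C
    have hc : Tendsto (fun k => eLpNorm (fun x => (F (vk k x) - F (v x)) • ∇ η x)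
        (ENNReal.ofReal p) (volume.restrict Ω)) atTop (𝓝 0) := by
      refine hscale C' (fun k x => ?_) hvkΩ
      rw [norm_smul, mul_comm]
      exact mul_le_mul (hC' x) (hFlip _ _) (norm_nonneg _) hC'0
    have hbm : ∀ k, AEStronglyMeasurable
        (fun x => ((deriv F (vk k x) - deriv F (v x)) * η x) • G x) (volume.restrict Ω) :=
      fun k => ((((hF'c.measurable.comp (hvks k).continuous.measurable).sub hF'vm).mul
        hηcont.measurable).aestronglyMeasurable).smul hGp.1
    -- `deriv F` is only known to be continuous and bounded, so this term converges by dominated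
    -- convergence with majorant `2C‖G‖`; the other two are controlled by `L^p` convergence of the
    -- mollifications.
    have hb : Tendsto (fun k => eLpNorm
        (fun x => ((deriv F (vk k x) - deriv F (v x)) * η x) • G x)
        (ENNReal.ofReal p) (volume.restrict Ω)) atTop (𝓝 0) := by
      refine tendsto_eLpNorm_zero_of_dominated hp0 hbm (hGp.norm.const_mul (2 * C)) (fun k => ?_) ?_
      · refine Eventually.of_forall fun x => ?_
        rw [norm_smul, norm_mul, norm_mul, norm_norm,
          Real.norm_of_nonneg (show (0 : ℝ) ≤ 2 * C by positivity)]
        gcongr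
        · calc _ ≤ ‖deriv F (vk k x)‖ + ‖deriv F (v x)‖ := norm_sub_le _ _
            _ ≤ 1 + 1 := add_le_add (hF' _) (hF' _)
            _ = 2 := by norm_num
        · exact hC x
      · filter_upwards [ae_restrict_of_ae hvkae, ae_restrict_mem hΩm] with x hx hxΩ
        have hvx : v1 x = v x := by simp [hv1, hxΩ]
        rw [hvx] at hx
        have h1 := (hF'c.tendsto (v x)).comp hx
        have h2 := ((h1.sub_const (deriv F (v x))).mul_const (η x)).smul_const (G x)
        simpa using h2
    have hsum := (ha.add hb).add hc
    simp only [add_zero] at hsum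
    refine tendsto_of_tendsto_of_tendsto_of_le_of_le tendsto_const_nhds hsum
      (fun _ => zero_le) fun k => ?_
    have ham : AEStronglyMeasurable (fun x => (deriv F (vk k x) * η x) • (Gk k x - G x))
        (volume.restrict Ω) :=
      ((hF'c.comp (hvks k).continuous).mul hηcont).aestronglyMeasurable.smul
        ((hGkc k).aestronglyMeasurable.sub hGp.1)
    have hcm : AEStronglyMeasurable (fun x => (F (vk k x) - F (v x)) • ∇ η x)
        (volume.restrict Ω) :=
      (((hF.continuous.measurable.comp (hvks k).continuous.measurable).sub hFvm).smul
        hη'cont.measurable).aestronglyMeasurable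
    have heq : (fun x => ∇ (ψ k) x - Φ x) =
        ((fun x => (deriv F (vk k x) * η x) • (Gk k x - G x)) +
          (fun x => ((deriv F (vk k x) - deriv F (v x)) * η x) • G x)) +
        (fun x => (F (vk k x) - F (v x)) • ∇ η x) := by
      ext1 x
      simp only [hψ', hΦ, Pi.add_apply]
      module
    rw [heq]
    refine (eLpNorm_add_le (ham.add (hbm k)) hcm hp1).trans ?_
    gcongr
    exact eLpNorm_add_le ham (hbm k) hp1
  refine ⟨fun x hx => ?_, hφp, hΦp, ψ, hlim1, hlim2⟩
  simp [image_eq_zero_of_notMem_tsupport fun h => hx (hηΩ h)]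

end WeakGradient

/-! ### Smooth convex truncations. -/

section Truncation

/-- Smooth convex substitutes for the truncation `t ↦ (k - t)_+`. -/
structure IsSmoothTruncation (k : ℝ) (F : ℝ → ℝ) : Prop where
  contDiff : ContDiff ℝ (⊤ : ℕ∞) F
  deriv_nonpos : ∀ t, deriv F t ≤ 0
  neg_one_le_deriv : ∀ t, -1 ≤ deriv F t
  tangent_le : ∀ a b, F a + deriv F a * (b - a) ≤ F b
  eq_zero : ∀ t, k ≤ t → F t = 0
  deriv_eq_zero : ∀ t, k ≤ t → deriv F t = 0

theorem IsSmoothTruncation.nonneg {k : ℝ} {F : ℝ → ℝ} (h : IsSmoothTruncation k F) (t : ℝ) :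
    0 ≤ F t := by
  simpa [h.eq_zero k le_rfl, h.deriv_eq_zero k le_rfl] using h.tangent_le k t

/-- This is the tangent at `t` evaluated at `k`, where `F` vanishes. Bounding `F` by its own slope
lets errors containing `F` be absorbed by good terms weighted with `-deriv F`. -/
theorem IsSmoothTruncation.le_mul_deriv {k : ℝ} {F : ℝ → ℝ} (h : IsSmoothTruncation k F) (t : ℝ) :
    F t ≤ (k - t) * (-deriv F t) := by
  have := h.tangent_le t k
  rw [h.eq_zero k le_rfl] at this
  linarith

theorem IsSmoothTruncation.antitone {k : ℝ} {F : ℝ → ℝ} (h : IsSmoothTruncation k F) :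
    Antitone F :=
  antitone_of_deriv_nonpos (h.contDiff.differentiable (by simp)) h.deriv_nonpos

theorem IsSmoothTruncation.abs_deriv_le {k : ℝ} {F : ℝ → ℝ} (h : IsSmoothTruncation k F) (t : ℝ) :
    |deriv F t| ≤ 1 :=
  abs_le.2 ⟨h.neg_one_le_deriv t, (h.deriv_nonpos t).trans zero_le_one⟩

/-- The profile `t e^{-1/t}` is convex with slope in `[0, 1]`. The formula is also right at `t = 0`,
where `expNegInvGlue` vanishes. -/
theorem hasDerivAt_mul_expNegInvGlue (t : ℝ) :
    HasDerivAt (fun t => t * expNegInvGlue t) ((1 + t⁻¹) * expNegInvGlue t) t := by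
  have h1 := expNegInvGlue.hasDerivAt_polynomial_eval_inv_mul 1 t
  simp only [Polynomial.eval_one, one_mul, Polynomial.derivative_one, sub_zero, mul_one,
    Polynomial.eval_pow, Polynomial.eval_X] at h1
  refine ((hasDerivAt_id t).mul h1).congr_deriv ?_
  rcases eq_or_ne t 0 with rfl | ht
  · simp
  · simp only [id]
    field_simp

theorem hasDerivAt_one_add_inv_mul_expNegInvGlue (t : ℝ) :
    HasDerivAt (fun t => (1 + t⁻¹) * expNegInvGlue t) (t⁻¹ ^ 3 * expNegInvGlue t) t := by
  have h1 := expNegInvGlue.hasDerivAt_polynomial_eval_inv_mul (1 + Polynomial.X) t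
  simp at h1
  convert h1 using 1
  field_simp

/-- The function is `δ f((k - t)/δ)` with `f(t) = t e^{-1/t}` for `t > 0`. Its slope bound is `1 +
1/t ≤ e^{1/t}`, and the scaling preserves slopes while multiplying heights by `δ`. Hence `c =
f(1/2)` serves all `k` and `δ`. -/
theorem exists_isSmoothTruncation :
    ∃ c : ℝ, 0 < c ∧ ∀ k δ : ℝ, 0 < δ → ∃ F, IsSmoothTruncation k F ∧
      ∀ t ≤ k - δ / 2, c * δ ≤ F t := by
  set f : ℝ → ℝ := fun t => t * expNegInvGlue t with hf
  have hfs : ContDiff ℝ (⊤ : ℕ∞) f := contDiff_id.mul expNegInvGlue.contDiff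
  have hd : deriv f = fun t => (1 + t⁻¹) * expNegInvGlue t :=
    funext fun t => (hasDerivAt_mul_expNegInvGlue t).deriv
  have hmono : Monotone (deriv f) := by
    rw [hd]
    refine monotone_of_deriv_nonneg
      (fun t => (hasDerivAt_one_add_inv_mul_expNegInvGlue t).differentiableAt) fun t => ?_
    rw [(hasDerivAt_one_add_inv_mul_expNegInvGlue t).deriv]
    rcases le_or_gt t 0 with ht | ht
    · simp [expNegInvGlue.zero_of_nonpos ht]
    · have := expNegInvGlue.nonneg t
      positivity
  have hconv : ConvexOn ℝ univ f := hmono.convexOn_univ_of_deriv (hfs.differentiable (by simp))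
  have hz : ∀ t ≤ 0, f t = 0 := fun t ht => by simp [hf, expNegInvGlue.zero_of_nonpos ht]
  have hdz : ∀ t ≤ 0, deriv f t = 0 := fun t ht => by
    simp [hd, expNegInvGlue.zero_of_nonpos ht]
  have hd0 : ∀ t, 0 ≤ deriv f t := fun t => by
    rcases le_or_gt t 0 with ht | ht
    · rw [hdz t ht]
    · rw [← hdz 0 le_rfl]; exact hmono ht.le
  have hd1 : ∀ t, deriv f t ≤ 1 := fun t => by
    rcases le_or_gt t 0 with ht | ht
    · rw [hdz t ht]; exact zero_le_one
    · rw [hd]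
      simp only [expNegInvGlue, ht.not_ge, if_false]
      rw [Real.exp_neg, ← div_eq_mul_inv, div_le_one (Real.exp_pos _), add_comm]
      exact Real.add_one_le_exp _
  have htan : ∀ a b, f a + deriv f a * (b - a) ≤ f b := by
    intro a b
    have hda := (hfs.differentiable (by simp) a)
    rcases lt_trichotomy a b with h | rfl | h
    · have h1 := hconv.deriv_le_slope (mem_univ a) (mem_univ b) h hda
      rw [slope_def_field, le_div_iff₀ (by linarith)] at h1
      linarith
    · simp
    · have h1 := hconv.slope_le_deriv (mem_univ b) (mem_univ a) h hda
      rw [slope_def_field, div_le_iff₀ (by linarith)] at h1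
      linarith
  refine ⟨f (1 / 2), mul_pos (by norm_num) (expNegInvGlue.pos_of_pos (by norm_num)),
    fun k δ hδ => ⟨fun t => δ * f ((k - t) / δ), ?_, ?_⟩⟩
  · have hF : ∀ t, HasDerivAt (fun t => δ * f ((k - t) / δ)) (-deriv f ((k - t) / δ)) t := by
      intro t
      have h1 := (hfs.differentiable (by simp) ((k - t) / δ)).hasDerivAt
      have h2 : HasDerivAt (fun t => (k - t) / δ) (-1 / δ) t :=
        ((hasDerivAt_id t).const_sub k).div_const δ
      refine ((h1.comp t h2).const_mul δ).congr_deriv ?_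
      field_simp
    have hF' : ∀ t, deriv (fun t => δ * f ((k - t) / δ)) t = -deriv f ((k - t) / δ) :=
      fun t => (hF t).deriv
    refine ⟨?_, fun t => ?_, fun t => ?_, fun a b => ?_, fun t ht => ?_, fun t ht => ?_⟩
    · exact contDiff_const.mul (hfs.comp ((contDiff_const.sub contDiff_id).div_const δ))
    · rw [hF']; linarith [hd0 ((k - t) / δ)]
    · rw [hF']; linarith [hd1 ((k - t) / δ)]
    · rw [hF']
      have h1 := mul_le_mul_of_nonneg_left (htan ((k - a) / δ) ((k - b) / δ)) hδ.le
      have h2 : (k - b) / δ - (k - a) / δ = -(b - a) / δ := by ring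
      rw [h2, mul_add] at h1
      have h3 : δ * (deriv f ((k - a) / δ) * (-(b - a) / δ)) =
          -deriv f ((k - a) / δ) * (b - a) := by
        field_simp
      linarith
    · rw [hz _ (div_nonpos_of_nonpos_of_nonneg (by linarith) hδ.le), mul_zero]
    · rw [hF', hdz _ (div_nonpos_of_nonpos_of_nonneg (by linarith) hδ.le), neg_zero]
  · intro t ht
    have hfm : Monotone f := monotone_of_deriv_nonneg (hfs.differentiable (by simp)) hd0
    rw [mul_comm]
    refine mul_le_mul_of_nonneg_left (hfm ?_) hδ.le
    rw [le_div_iff₀ hδ]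
    linarith

end Truncation

/-! ### Cutoff functions between balls. -/

section Cutoff

theorem exists_abs_deriv_smoothTransition_le :
    ∃ C : ℝ, 0 < C ∧ ∀ t, |deriv Real.smoothTransition t| ≤ C := by
  have hc : Continuous (deriv Real.smoothTransition) :=
    (Real.smoothTransition.contDiff (n := 1)).continuous_deriv le_rfl
  have hs : HasCompactSupport (deriv Real.smoothTransition) := by
    refine HasCompactSupport.intro (isCompact_Icc (a := (0 : ℝ)) (b := 1)) fun t ht => ?_
    rw [mem_Icc, not_and_or, not_le, not_le] at ht
    rcases ht with ht | ht
    · have : Real.smoothTransition =ᶠ[𝓝 t] fun _ => 0 := by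
        filter_upwards [gt_mem_nhds ht] with y hy
        exact Real.smoothTransition.zero_of_nonpos hy.le
      rw [this.deriv_eq, deriv_const]
    · have : Real.smoothTransition =ᶠ[𝓝 t] fun _ => 1 := by
        filter_upwards [lt_mem_nhds ht] with y hy
        exact Real.smoothTransition.one_of_one_le hy.le
      rw [this.deriv_eq, deriv_const]
  obtain ⟨C, hC⟩ := hc.bounded_above_of_compact_support hs
  exact ⟨max C 1, by positivity, fun t => (hC t).trans (le_max_left _ _)⟩

/-- Smooth cutoff functions between concentric balls, with gradients bounded by a multiple of the
inverse of the difference of the radii. -/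
theorem exists_cutoff (E : Type*) [NormedAddCommGroup E] [InnerProductSpace ℝ E] :
    ∃ C : ℝ, 0 < C ∧ ∀ (x₀ : E) (r' r : ℝ), 0 < r' → r' < r → ∃ ζ : E → ℝ,
      ContDiff ℝ (⊤ : ℕ∞) ζ ∧ (∀ x, 0 ≤ ζ x) ∧ (∀ x, ζ x ≤ 1) ∧ (∀ x ∈ ball x₀ r', ζ x = 1) ∧
      Function.support ζ ⊆ ball x₀ r ∧ (∀ x, ‖fderiv ℝ ζ x‖ ≤ C / (r - r')) ∧
      ∀ x y, |ζ x - ζ y| ≤ C / (r - r') * ‖x - y‖ := by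
  obtain ⟨C, hC0, hC⟩ := exists_abs_deriv_smoothTransition_le
  refine ⟨2 * C, by positivity, fun x₀ r' r hr' hr => ?_⟩
  have hD : 0 < r ^ 2 - r' ^ 2 := by nlinarith
  -- The squared norm keeps `q` smooth at the centre; its gradient on the larger ball is at most `2r
  -- / (r² - r'²) ≤ 2 / (r - r')`.
  set q : E → ℝ := fun x => (r ^ 2 - ‖x - x₀‖ ^ 2) / (r ^ 2 - r' ^ 2) with hq
  have hqs : ContDiff ℝ (⊤ : ℕ∞) q :=
    (contDiff_const.sub ((contDiff_id.sub contDiff_const).norm_sq ℝ)).div_const _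
  have hS : ContDiff ℝ (⊤ : ℕ∞) Real.smoothTransition := Real.smoothTransition.contDiff
  have hζs : ContDiff ℝ (⊤ : ℕ∞) (fun x => Real.smoothTransition (q x)) := hS.comp hqs
  have hsupp : Function.support (fun x => Real.smoothTransition (q x)) ⊆ ball x₀ r := by
    intro x hx
    by_contra hxr
    apply hx
    apply Real.smoothTransition.zero_of_nonpos
    rw [mem_ball, dist_eq_norm, not_lt] at hxr
    refine div_nonpos_of_nonpos_of_nonneg ?_ hD.le
    nlinarith [hr'.trans hr]
  have hgrad : ∀ x, ‖fderiv ℝ (fun x => Real.smoothTransition (q x)) x‖ ≤ 2 * C / (r - r') := by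
    intro x
    by_cases hx : x ∈ closedBall x₀ r
    · rw [mem_closedBall, dist_eq_norm] at hx
      have h1 : HasFDerivAt q ((r ^ 2 - r' ^ 2)⁻¹ • -((2 : ℝ) • innerSL ℝ (x - x₀))) x := by
        have h2 := ((hasFDerivAt_id x).sub_const x₀).norm_sq
        have h3 := (h2.const_sub (r ^ 2)).mul_const (r ^ 2 - r' ^ 2)⁻¹
        refine h3.congr_fderiv ?_
        ext e
        simp
      have h4 := ((hS.differentiable (by simp) (q x)).hasDerivAt.comp_hasFDerivAt x h1).fderiv
      have h4' : fderiv ℝ (fun x => Real.smoothTransition (q x)) x = _ := h4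
      rw [h4', norm_smul, norm_smul, norm_neg, norm_smul, innerSL_apply_norm]
      rw [Real.norm_of_nonneg (inv_nonneg.2 hD.le), Real.norm_eq_abs, Real.norm_two]
      calc |deriv Real.smoothTransition (q x)| * ((r ^ 2 - r' ^ 2)⁻¹ * (2 * ‖x - x₀‖))
          ≤ C * ((r ^ 2 - r' ^ 2)⁻¹ * (2 * r)) := by
            gcongr
            exact hC _
        _ ≤ 2 * C / (r - r') := by
            have hrr : 0 < r - r' := by linarith
            rw [le_div_iff₀ hrr]
            have : (r ^ 2 - r' ^ 2)⁻¹ = (r - r')⁻¹ * (r + r')⁻¹ := by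
              rw [← mul_inv]; congr 1; ring
            rw [this]
            have h5 : r * (r + r')⁻¹ ≤ 1 := by
              rw [← div_eq_mul_inv, div_le_one (by linarith)]; linarith
            calc C * ((r - r')⁻¹ * (r + r')⁻¹ * (2 * r)) * (r - r')
                = 2 * C * (r * (r + r')⁻¹) * ((r - r')⁻¹ * (r - r')) := by ring
              _ ≤ 2 * C * 1 * ((r - r')⁻¹ * (r - r')) := by gcongr
              _ = 2 * C := by rw [inv_mul_cancel₀ hrr.ne']; ring
    · have : fderiv ℝ (fun x => Real.smoothTransition (q x)) x = 0 := by
        by_contra h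
        have h6 := support_fderiv_subset ℝ h
        exact hx (closure_ball_subset_closedBall (closure_mono hsupp h6))
      rw [this, norm_zero]
      have : 0 < r - r' := by linarith
      positivity
  refine ⟨fun x => Real.smoothTransition (q x), hζs, fun x => Real.smoothTransition.nonneg _,
    fun x => Real.smoothTransition.le_one _, fun x hx => ?_, hsupp, hgrad, fun x y => ?_⟩
  · apply Real.smoothTransition.one_of_one_le
    rw [mem_ball, dist_eq_norm] at hx
    rw [hq, le_div_iff₀ hD]
    nlinarith [norm_nonneg (x - x₀)]
  · have := Convex.norm_image_sub_le_of_norm_fderiv_le (𝕜 := ℝ)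
      (fun x _ => hζs.differentiable (by simp) x) (fun x _ => hgrad x) convex_univ
      (mem_univ y) (mem_univ x)
    simpa using this

end Cutoff

/-! ### Integrability of the truncated kernel. -/

section KernelIntegrability

/-- Integrability of the truncated singular kernel. -/
theorem integrable_min_rpow_div {E : Type*} [NormedAddCommGroup E] [NormedSpace ℝ E]
    [FiniteDimensional ℝ E] [MeasurableSpace E] [BorelSpace E] {μ : Measure E}
    [μ.IsAddHaarMeasure] {n : ℕ} (hE : Module.finrank ℝ E = n) (hn : 1 ≤ n) {p s : ℝ}
    (hp : 1 < p) (hs0 : 0 < s) (hs1 : s < 1) :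
    Integrable (fun z : E => min 1 ‖z‖ ^ p / ‖z‖ ^ ((n : ℝ) + p * s)) μ := by
  have hps : 0 < p * s := by positivity
  have hmeas : Measurable (fun z : E => min 1 ‖z‖ ^ p / ‖z‖ ^ ((n : ℝ) + p * s)) := by
    fun_prop
  rw [← integrableOn_univ, ← union_compl_self (ball (0 : E) 1)]
  -- Near the origin the function is `‖z‖^(p-n-ps)`, integrable because `s < 1`; at infinity it is
  -- `‖z‖^(-n-ps)`, integrable because `ps > 0`.
  refine IntegrableOn.union ?_ ?_
  · refine integrableOn_ball_of_norm_le_rpow (C := 1) (α := n + p * s - p) (by omega) ?_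
      ?_ hmeas.aestronglyMeasurable
    · rw [hE]; nlinarith
    · filter_upwards [ae_restrict_mem measurableSet_ball] with z hz
      rw [mem_ball_zero_iff] at hz
      rw [one_mul, min_eq_right hz.le, Real.norm_of_nonneg (by positivity)]
      rcases (norm_nonneg z).eq_or_lt with h0 | h0
      · rw [← h0, Real.zero_rpow (by linarith), zero_div]
        positivity
      · rw [← Real.rpow_sub h0]
        exact le_of_eq (by congr 1; ring)
  · have h1 := (integrable_one_add_norm (E := E) (μ := μ) (r := n + p * s)
      (by rw [hE]; linarith)).const_mul (2 ^ ((n : ℝ) + p * s))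
    refine (h1.integrableOn (s := (ball (0 : E) 1)ᶜ)).mono' hmeas.aestronglyMeasurable ?_
    filter_upwards [ae_restrict_mem measurableSet_ball.compl] with z hz
    rw [mem_compl_iff, mem_ball_zero_iff, not_lt] at hz
    rw [min_eq_left hz, Real.one_rpow, Real.norm_of_nonneg (by positivity),
      Real.rpow_neg (by positivity), ← div_eq_mul_inv,
      div_le_div_iff₀ (by positivity) (by positivity), one_mul,
      ← Real.mul_rpow (by norm_num) (by positivity)]
    gcongr
    linarith

end KernelIntegrability

/-! ### Fast geometric convergence of recursive sequences. -/

section FastConvergence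

/-- Fast geometric convergence. -/
theorem exists_tendsto_zero_of_le_mul_pow {C b α : ℝ} (hC : 0 < C) (hb : 1 < b) (hα : 0 < α) :
    ∃ ν : ℝ, 0 < ν ∧ ∀ Y : ℕ → ℝ, (∀ j, 0 ≤ Y j) →
      (∀ j, Y (j + 1) ≤ C * b ^ j * Y j ^ (1 + α)) → Y 0 ≤ ν → Tendsto Y atTop (𝓝 0) := by
  have hb0 : 0 < b := by linarith
  -- The choices `q^α = 1/b` and `ν^α = q/C` make `ν q^j` an exact solution of the recursion, which
  -- then dominates `Y`.
  set q : ℝ := b ^ (-(1 / α)) with hq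
  have hq0 : 0 < q := Real.rpow_pos_of_pos hb0 _
  have hq1 : q < 1 := Real.rpow_lt_one_of_one_lt_of_neg hb (by simpa using hα)
  have hqα : q ^ α = b⁻¹ := by
    rw [hq, ← Real.rpow_mul hb0.le, neg_mul, one_div, inv_mul_cancel₀ hα.ne', Real.rpow_neg_one]
  set ν : ℝ := (q / C) ^ (1 / α) with hν
  have hν0 : 0 < ν := by positivity
  have hνα : ν ^ α = q / C := by
    rw [hν, ← Real.rpow_mul (by positivity), one_div, inv_mul_cancel₀ hα.ne', Real.rpow_one]
  refine ⟨ν, hν0, fun Y hY0 hY hν1 => ?_⟩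
  have hind : ∀ j, Y j ≤ ν * q ^ j := by
    intro j
    induction j with
    | zero => simpa using hν1
    | succ j ih =>
      calc Y (j + 1) ≤ C * b ^ j * Y j ^ (1 + α) := hY j
        _ ≤ C * b ^ j * (ν * q ^ j) ^ (1 + α) := by
            gcongr
            exact hY0 j
        _ = ν * q ^ j * (C * ν ^ α) * (b ^ j * (q ^ α) ^ j) := by
            rw [Real.rpow_add (by positivity), Real.rpow_one, Real.mul_rpow hν0.le (by positivity),
              ← Real.rpow_natCast q j, ← Real.rpow_mul hq0.le, mul_comm (j : ℝ) α,
              Real.rpow_mul hq0.le, Real.rpow_natCast (q ^ α) j]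
            ring
        _ = ν * q ^ (j + 1) := by
            rw [hνα, hqα, ← mul_pow, mul_inv_cancel₀ hb0.ne', one_pow, mul_div_cancel₀ _ hC.ne']
            ring
  refine squeeze_zero hY0 hind ?_
  simpa using (tendsto_pow_atTop_nhds_zero_of_lt_one hq0.le hq1).const_mul ν

end FastConvergence

/-! ### Pointwise inequalities behind the energy estimate. -/

section PointwiseEstimates

/-- A form of Young's inequality whose coefficient `1/2` leaves room for absorption; the cases split
at `t = 2c`. -/
theorem rpow_sub_one_mul_le {p t c : ℝ} (hp : 1 < p) (ht : 0 ≤ t) (hc : 0 ≤ c) :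
    t ^ (p - 1) * c ≤ t ^ p / 2 + 2 ^ (p - 1) * c ^ p := by
  have hsplit : ∀ y : ℝ, 0 ≤ y → y ^ (p - 1) * y = y ^ p := fun y hy => by
    rw [← Real.rpow_add_one' hy (by linarith), sub_add_cancel]
  rcases le_total (2 * c) t with h | h
  · have h1 : t ^ (p - 1) * c ≤ t ^ (p - 1) * (t / 2) := by gcongr; linarith
    have h2 := hsplit t ht
    have h3 : 0 ≤ (2 : ℝ) ^ (p - 1) * c ^ p := by positivity
    nlinarith
  · have h1 : t ^ (p - 1) * c ≤ (2 * c) ^ (p - 1) * c := by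
      gcongr
    rw [Real.mul_rpow (by norm_num) hc, mul_assoc, hsplit c hc] at h1
    have h3 : 0 ≤ t ^ p := by positivity
    linarith

theorem rpow_sub_one_mul_le_add {p t c : ℝ} (hp : 1 < p) (ht : 0 ≤ t) (hc : 0 ≤ c) :
    t ^ (p - 1) * c ≤ t ^ p + c ^ p := by
  have hsplit : ∀ y : ℝ, 0 ≤ y → y ^ (p - 1) * y = y ^ p := fun y hy => by
    rw [← Real.rpow_add_one' hy (by linarith), sub_add_cancel]
  rcases le_total c t with h | h
  · have h1 : t ^ (p - 1) * c ≤ t ^ (p - 1) * t := by gcongr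
    rw [hsplit t ht] at h1
    have : 0 ≤ c ^ p := by positivity
    linarith
  · have h1 : t ^ (p - 1) * c ≤ c ^ (p - 1) * c := by gcongr
    rw [hsplit c hc] at h1
    have : 0 ≤ t ^ p := by positivity
    linarith

/-- The cutoff carries a natural exponent at least `p`, so that its power stays smooth. This
comparison lets that power cancel the `z^(-p)` produced by Young's inequality. -/
theorem pow_le_rpow_of_le_one {z p : ℝ} {m : ℕ} (hz0 : 0 ≤ z) (hz1 : z ≤ 1) (hp : 0 < p)
    (hm : p ≤ m) : z ^ m ≤ z ^ p := by
  rcases hz0.eq_or_lt with rfl | hz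
  · have : m ≠ 0 := by rintro rfl; simp at hm; linarith
    rw [zero_pow this, Real.zero_rpow hp.ne']
  · rw [← Real.rpow_natCast]
    exact Real.rpow_le_rpow_of_exponent_ge hz hz1 hm

theorem pow_sub_pow_le_mul {x y : ℝ} (hy : 0 ≤ y) (hxy : y ≤ x) (m : ℕ) :
    x ^ (m + 1) - y ^ (m + 1) ≤ (m + 1 : ℕ) * x ^ m * (x - y) := by
  induction m with
  | zero => simp
  | succ m ih =>
    have hx : 0 ≤ x := hy.trans hxy
    have h1 : y * (x ^ (m + 1) - y ^ (m + 1)) ≤ x * ((m + 1 : ℕ) * x ^ m * (x - y)) :=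
      mul_le_mul hxy ih (sub_nonneg.2 (pow_le_pow_left₀ hy hxy _)) hx
    push_cast at h1 ⊢
    calc x ^ (m + 1 + 1) - y ^ (m + 1 + 1)
        = x ^ (m + 1) * (x - y) + y * (x ^ (m + 1) - y ^ (m + 1)) := by ring
      _ ≤ x ^ (m + 1) * (x - y) + x * ((m + 1) * x ^ m * (x - y)) := by gcongr
      _ = _ := by ring

/-- Absorption of the cutoff term in the local part of the energy estimate. -/
theorem norm_rpow_le_neg_inner_add {V : Type*} [NormedAddCommGroup V] [InnerProductSpace ℝ V]
    {p D N d f z : ℝ} {m : ℕ} (hp : 1 < p) (hm : p ≤ (m + 1 : ℕ)) (hD : 0 ≤ D) (hN : 0 ≤ N)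
    (hd0 : 0 ≤ d) (hd1 : d ≤ 1) (hf0 : 0 ≤ f) (hf : f ≤ D * d) (hz0 : 0 < z) (hz1 : z ≤ 1)
    {G Z Φ : V} (hZ : ‖Z‖ ≤ N)
    (hΦ : Φ = (-d * z ^ (m + 1)) • G + (f * ((m + 1 : ℕ) * z ^ m)) • Z) :
    ‖Φ‖ ^ p ≤ -2 ^ (p + 1) * (‖G‖ ^ (p - 2) * inner ℝ G Φ) +
      2 ^ p * (2 ^ p + 1) * (D * (m + 1 : ℕ)) ^ p * N ^ p := by
  set t := ‖G‖ with ht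
  have ht0 : 0 ≤ t := norm_nonneg _
  set M : ℝ := ((m + 1 : ℕ) : ℝ) with hM
  have hM0 : 0 ≤ M := Nat.cast_nonneg _
  have hp0 : 0 < p := by linarith
  set Q := (D * M * N) ^ p with hQ
  have hQ0 : 0 ≤ Q := by positivity
  have hGG : t ^ (p - 2) * inner ℝ G G = t ^ p := by
    rw [real_inner_self_eq_norm_sq, ← ht]
    -- For `p < 2` the exponent `p - 2` is negative; where `G = 0` the value of `0 ^ (p - 2)` is
    -- irrelevant, since the inner product vanishes.
    rcases ht0.eq_or_lt with h | h
    · rw [← h, Real.zero_rpow hp0.ne']; simp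
    · rw [← Real.rpow_natCast, ← Real.rpow_add h]; norm_num
  have hGZ : t ^ (p - 2) * inner ℝ G Z ≤ t ^ (p - 1) * N := by
    rcases ht0.eq_or_lt with h | h
    · have : G = 0 := norm_eq_zero.1 h.symm
      rw [this, inner_zero_left, mul_zero]
      positivity
    · calc t ^ (p - 2) * inner ℝ G Z ≤ t ^ (p - 2) * (t * N) := by
            gcongr
            exact (real_inner_le_norm G Z).trans (by gcongr)
        _ = t ^ (p - 2 + 1) * N := by rw [Real.rpow_add_one h.ne']; ring
        _ = _ := by congr 2; ring
  have hX : t ^ (p - 2) * inner ℝ G Φ ≤ -(d * z ^ (m + 1) * t ^ p) / 2 + 2 ^ (p - 1) * Q := by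
    have e1 : t ^ (p - 2) * inner ℝ G Φ = -(d * z ^ (m + 1)) * (t ^ (p - 2) * inner ℝ G G) +
        f * (M * z ^ m) * (t ^ (p - 2) * inner ℝ G Z) := by
      rw [hΦ, inner_add_right, inner_smul_right, inner_smul_right]; ring
    have e2 : f * (M * z ^ m) * (t ^ (p - 2) * inner ℝ G Z) ≤
        f * (M * z ^ m) * (t ^ (p - 1) * N) := by gcongr
    -- By `f ≤ D d` the cutoff term acquires the weight `d z^(m+1)` of the gradient term, at the
    -- price of `1/z` inside Young's inequality.
    have e3 : f * (M * z ^ m) * (t ^ (p - 1) * N) ≤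
        d * z ^ (m + 1) * (t ^ (p - 1) * (D * M * N / z)) := by
      calc f * (M * z ^ m) * (t ^ (p - 1) * N) ≤ D * d * (M * z ^ m) * (t ^ (p - 1) * N) := by
            gcongr
        _ = _ := by field_simp; ring
    have e4 := mul_le_mul_of_nonneg_left
      (rpow_sub_one_mul_le hp ht0 (c := D * M * N / z) (by positivity))
      (show 0 ≤ d * z ^ (m + 1) by positivity)
    have e5 : d * z ^ (m + 1) * (D * M * N / z) ^ p ≤ Q := by
      rw [Real.div_rpow (by positivity) hz0.le, ← hQ]
      have h1 := pow_le_rpow_of_le_one hz0.le hz1 hp0 hm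
      calc d * z ^ (m + 1) * (Q / z ^ p) ≤ 1 * z ^ p * (Q / z ^ p) := by gcongr
        _ = Q := by field_simp
    have e6 : 2 ^ (p - 1) * (d * z ^ (m + 1) * (D * M * N / z) ^ p) ≤ 2 ^ (p - 1) * Q := by
      gcongr
    rw [e1, hGG]
    linarith
  have hn : ‖Φ‖ ≤ d * z ^ (m + 1) * t + D * M * N := by
    rw [hΦ]
    refine (norm_add_le _ _).trans ?_
    rw [norm_smul, norm_smul, Real.norm_eq_abs, neg_mul, abs_neg,
      abs_of_nonneg (show 0 ≤ d * z ^ (m + 1) by positivity),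
      Real.norm_of_nonneg (show 0 ≤ f * (M * z ^ m) by positivity)]
    have h1 : f * (M * z ^ m) ≤ D * M := by
      calc f * (M * z ^ m) ≤ (D * 1) * (M * 1) := by
            gcongr
            · exact hf.trans (by gcongr)
            · exact pow_le_one₀ hz0.le hz1
        _ = D * M := by ring
    exact add_le_add le_rfl (mul_le_mul h1 hZ (norm_nonneg _) (by positivity))
  have hn2 : ‖Φ‖ ^ p ≤ 2 ^ p * (d * z ^ (m + 1) * t ^ p + Q) := by
    -- The weight lies in `[0, 1]`, so its `p`-th power is at most its first power, the one
    -- controlled by the gradient term.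
    have hw0 : 0 ≤ d * z ^ (m + 1) := by positivity
    have hw1 : d * z ^ (m + 1) ≤ 1 := mul_le_one₀ hd1 (by positivity) (pow_le_one₀ hz0.le hz1)
    have h1 : (d * z ^ (m + 1) * t) ^ p ≤ d * z ^ (m + 1) * t ^ p := by
      rw [Real.mul_rpow hw0 ht0]
      gcongr
      simpa using Real.rpow_le_rpow_of_exponent_ge' hw0 hw1 zero_le_one hp.le
    set x := d * z ^ (m + 1) * t
    have hx0 : 0 ≤ x := by positivity
    set y := D * M * N
    have hy0 : 0 ≤ y := by positivity
    calc ‖Φ‖ ^ p ≤ (x + y) ^ p := by gcongr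
      _ ≤ (2 * max x y) ^ p := by
          gcongr
          linarith [le_max_left x y, le_max_right x y]
      _ = 2 ^ p * (max x y) ^ p := Real.mul_rpow (by norm_num) (by positivity)
      _ ≤ 2 ^ p * (x ^ p + y ^ p) := by
          gcongr
          rcases le_total x y with h | h
          · rw [max_eq_right h]; have : 0 ≤ x ^ p := by positivity
            linarith
          · rw [max_eq_left h]; have : 0 ≤ y ^ p := by positivity
            linarith
      _ ≤ _ := by gcongr
  have hQ' : (D * M) ^ p * N ^ p = Q := by rw [hQ, Real.mul_rpow (by positivity) hN]
  rw [mul_assoc (2 ^ p * (2 ^ p + 1)), hQ']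
  have h2 : (2 : ℝ) ^ (p + 1) = 2 ^ p * 2 := by rw [Real.rpow_add_one (by norm_num)]
  have h3 : (2 : ℝ) ^ (p - 1) * 2 = 2 ^ p := by
    rw [← Real.rpow_add_one (by norm_num), sub_add_cancel]
  have h4 : (0 : ℝ) < 2 ^ p := by positivity
  have h5 := mul_le_mul_of_nonneg_left hX (show (0 : ℝ) ≤ 2 ^ (p + 1) by positivity)
  have h6 : (2 : ℝ) ^ (p - 1) = 2 ^ p / 2 := by linarith
  rw [h2] at h5 ⊢
  rw [h6] at h5
  linarith

/-- Absorption of the cutoff term in the nonlocal part of the energy estimate. -/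
theorem nonlocal_integrand_le_of_le {p D T k a b x y : ℝ} {m : ℕ} {F : ℝ → ℝ} (hp : 1 < p)
    (hm : p ≤ (m + 1 : ℕ)) (hF : IsSmoothTruncation k F) (hD : 0 ≤ D) (haD : k - a ≤ D)
    (hba : b ≤ a) (habT : a - b ≤ T) (hx0 : 0 ≤ x) (hx1 : x ≤ 1) (hy0 : 0 ≤ y) :
    |a - b| ^ (p - 2) * (a - b) * (F a * x ^ (m + 1) - F b * y ^ (m + 1)) ≤
      (T ^ (p - 1) * D * 2 ^ p + (2 ^ (m + 1) * D * (m + 1 : ℕ)) ^ p) * |x - y| ^ p *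
        (if a < k ∧ 0 < x then 1 else 0) := by
  have hp0 : 0 < p := by linarith
  set t := a - b with ht
  have ht0 : 0 ≤ t := by linarith
  have hT0 : 0 ≤ T := ht0.trans habT
  have hJ : |t| ^ (p - 2) * t = t ^ (p - 1) := by
    rw [abs_of_nonneg ht0]
    rcases ht0.eq_or_lt with h | h
    · rw [← h, Real.zero_rpow (sub_pos.2 hp).ne', mul_zero]
    · rw [← Real.rpow_add_one h.ne']; congr 1; ring
  rw [hJ]
  have htp : 0 ≤ t ^ (p - 1) := by positivity
  have hFb : F a ≤ F b := hF.antitone hba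
  have hFa0 := hF.nonneg a
  have hFb0 := hF.nonneg b
  by_cases hA : a < k ∧ 0 < x
  swap
  · rw [if_neg hA, mul_zero]
    have : F a * x ^ (m + 1) = 0 := by
      rcases not_and_or.1 hA with h | h
      · rw [hF.eq_zero a (not_lt.1 h), zero_mul]
      · rw [le_antisymm (not_lt.1 h) hx0]; simp
    rw [this, zero_sub]
    have : 0 ≤ F b * y ^ (m + 1) := by positivity
    exact mul_nonpos_of_nonneg_of_nonpos htp (by linarith)
  rw [if_pos hA, mul_one]
  have hx := hA.2
  set C1 := T ^ (p - 1) * D * 2 ^ p with hC1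
  set C2 := (2 ^ (m + 1) * D * (m + 1 : ℕ)) ^ p with hC2
  have hC10 : 0 ≤ C1 := by positivity
  have hC20 : 0 ≤ C2 := by positivity
  have hΔ0 : 0 ≤ |x - y| ^ p := by positivity
  have hd0 : 0 ≤ -deriv F a := by linarith [hF.deriv_nonpos a]
  have hd1 : -deriv F a ≤ 1 := by linarith [hF.neg_one_le_deriv a]
  have hFd : F a ≤ D * (-deriv F a) := (hF.le_mul_deriv a).trans (by gcongr)
  have hFaD : F a ≤ D := hFd.trans (mul_le_of_le_one_right hD hd1)
  rcases le_total x y with hxy | hxy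
  · have : F a * x ^ (m + 1) ≤ F b * y ^ (m + 1) := by gcongr
    have h1 : t ^ (p - 1) * (F a * x ^ (m + 1) - F b * y ^ (m + 1)) ≤ 0 :=
      mul_nonpos_of_nonneg_of_nonpos htp (by linarith)
    exact h1.trans (by positivity)
  rw [abs_of_nonneg (sub_nonneg.2 hxy)] at hΔ0 ⊢
  set Δ := x - y with hΔ
  have hΔ' : 0 ≤ Δ := sub_nonneg.2 hxy
  -- If the cutoff at least halves, then `x ≤ 2 (x - y)` and crude bounds suffice. Otherwise `y` is
  -- comparable with `x`, and the gain from convexity survives at `b`.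
  rcases le_total y (x / 2) with hy | hy
  · have h1 : x ≤ 2 * Δ := by rw [hΔ]; linarith
    calc t ^ (p - 1) * (F a * x ^ (m + 1) - F b * y ^ (m + 1))
        ≤ T ^ (p - 1) * (D * x ^ p) := by
          have h2 : 0 ≤ F b * y ^ (m + 1) := by positivity
          have h3 : F a * x ^ (m + 1) ≤ D * x ^ p := by
            gcongr
            exact pow_le_rpow_of_le_one hx0 hx1 hp0 hm
          calc _ ≤ t ^ (p - 1) * (D * x ^ p) := by gcongr; linarith
            _ ≤ _ := by gcongr
      _ ≤ T ^ (p - 1) * (D * (2 * Δ) ^ p) := by gcongr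
      _ = C1 * Δ ^ p := by rw [Real.mul_rpow (by norm_num) hΔ', hC1]; ring
      _ ≤ (C1 + C2) * Δ ^ p := by gcongr; linarith
  · set d := -deriv F a with hd
    have htan : F a + d * t ≤ F b := by
      have := hF.tangent_le a b
      rw [hd, ht]; linarith
    -- Convexity gives `F b ≥ F a + d t`, and `y ≥ x/2` turns the gain into `-d t x^(m+1) /
    -- 2^(m+1)`. With this `c`, the cutoff error is at most the same weight times `c`, and Young's
    -- inequality absorbs `t^(p-1) c`.
    set c := 2 ^ (m + 1) * D * (m + 1 : ℕ) * Δ / x with hc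
    have hc0 : 0 ≤ c := by positivity
    have h1 : F a * x ^ (m + 1) - F b * y ^ (m + 1) ≤
        d * (x ^ (m + 1) / 2 ^ (m + 1)) * (c - t) := by
      have e1 : F a * (x ^ (m + 1) - y ^ (m + 1)) ≤
          D * d * ((m + 1 : ℕ) * x ^ m * Δ) := by
        refine mul_le_mul hFd (pow_sub_pow_le_mul hy0 hxy m)
          (sub_nonneg.2 (pow_le_pow_left₀ hy0 hxy _)) (by positivity)
      have e2 : D * d * ((m + 1 : ℕ) * x ^ m * Δ) = d * (x ^ (m + 1) / 2 ^ (m + 1)) * c := by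
        rw [hc]; field_simp; ring
      have e3 : d * t * (x ^ (m + 1) / 2 ^ (m + 1)) ≤ d * t * y ^ (m + 1) := by
        rw [← div_pow]; gcongr
      have e4 : (F a + d * t) * y ^ (m + 1) ≤ F b * y ^ (m + 1) := by gcongr
      nlinarith
    have h2 : t ^ (p - 1) * (c - t) ≤ c ^ p := by
      have e1 := rpow_sub_one_mul_le_add hp ht0 hc0
      have e2 : t ^ (p - 1) * t = t ^ p := by
        rw [← Real.rpow_add_one' ht0 (by linarith), sub_add_cancel]
      rw [mul_sub, e2]; linarith
    have h3 : x ^ (m + 1) * c ^ p ≤ C2 * Δ ^ p := by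
      rw [hc, Real.div_rpow (by positivity) hx0, Real.mul_rpow (by positivity) hΔ', ← hC2]
      have := pow_le_rpow_of_le_one hx0 hx1 hp0 hm
      calc x ^ (m + 1) * (C2 * Δ ^ p / x ^ p) ≤ x ^ p * (C2 * Δ ^ p / x ^ p) := by gcongr
        _ = _ := by field_simp
    calc t ^ (p - 1) * (F a * x ^ (m + 1) - F b * y ^ (m + 1))
        ≤ t ^ (p - 1) * (d * (x ^ (m + 1) / 2 ^ (m + 1)) * (c - t)) := by gcongr
      _ = d * (x ^ (m + 1) / 2 ^ (m + 1)) * (t ^ (p - 1) * (c - t)) := by ring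
      _ ≤ d * (x ^ (m + 1) / 2 ^ (m + 1)) * c ^ p := by gcongr
      _ ≤ 1 * (x ^ (m + 1) / 1) * c ^ p := by
          gcongr
          exact one_le_pow₀ (by norm_num)
      _ = x ^ (m + 1) * c ^ p := by ring
      _ ≤ C2 * Δ ^ p := h3
      _ ≤ (C1 + C2) * Δ ^ p := by gcongr; linarith

/-- Exchanging `(a, x)` with `(b, y)` leaves the left side unchanged, so the ordered case applies to
whichever value is larger; the sum of the indicators covers both orders. -/
theorem nonlocal_integrand_le {p D T k a b x y : ℝ} {m : ℕ} {F : ℝ → ℝ} (hp : 1 < p)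
    (hm : p ≤ (m + 1 : ℕ)) (hF : IsSmoothTruncation k F) (hD : 0 ≤ D) (haD : k - a ≤ D)
    (hbD : k - b ≤ D) (habT : |a - b| ≤ T) (hx0 : 0 ≤ x) (hx1 : x ≤ 1) (hy0 : 0 ≤ y)
    (hy1 : y ≤ 1) :
    |a - b| ^ (p - 2) * (a - b) * (F a * x ^ (m + 1) - F b * y ^ (m + 1)) ≤
      (T ^ (p - 1) * D * 2 ^ p + (2 ^ (m + 1) * D * (m + 1 : ℕ)) ^ p) * |x - y| ^ p *
        ((if a < k ∧ 0 < x then 1 else 0) + (if b < k ∧ 0 < y then 1 else 0)) := by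
  have hT0 : 0 ≤ T := (abs_nonneg _).trans habT
  have hC : 0 ≤ (T ^ (p - 1) * D * 2 ^ p + (2 ^ (m + 1) * D * (m + 1 : ℕ)) ^ p) * |x - y| ^ p := by
    positivity
  have hi : ∀ q : Prop, [Decidable q] → (0 : ℝ) ≤ if q then 1 else 0 := by
    intro q _; split_ifs <;> norm_num
  rcases le_total b a with h | h
  · refine (nonlocal_integrand_le_of_le hp hm hF hD haD h ((le_abs_self _).trans habT)
      hx0 hx1 hy0).trans ?_
    gcongr
    linarith [hi (b < k ∧ 0 < y)]
  · have h1 := nonlocal_integrand_le_of_le hp hm hF hD hbD h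
      ((le_abs_self _).trans ((abs_sub_comm b a).trans_le habT)) hy0 hy1 hx0
    rw [abs_sub_comm b a, abs_sub_comm y x] at h1
    calc _ = |a - b| ^ (p - 2) * (b - a) * (F b * y ^ (m + 1) - F a * x ^ (m + 1)) := by ring
      _ ≤ _ := h1
      _ ≤ _ := by
        gcongr
        linarith [hi (a < k ∧ 0 < x)]

end PointwiseEstimates

/-! ### The energy estimate. -/

section Energy

variable {n : ℕ}

local notation "E" => EuclideanSpace ℝ (Fin n)

/-- An upper bound for a Bochner integral that does not require integrability of the smaller
function. -/
theorem integral_le_of_le_of_nonneg {α : Type*} [MeasurableSpace α] {μ : Measure α} {f g : α → ℝ}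
    (hg : Integrable g μ) (hg0 : ∀ x, 0 ≤ g x) (hfg : ∀ x, f x ≤ g x) :
    ∫ x, f x ∂μ ≤ ∫ x, g x ∂μ := by
  by_cases hf : Integrable f μ
  · exact integral_mono hf hg hfg
  · rw [integral_undef hf]
    exact integral_nonneg hg0

/-- Integrals of translates of an even kernel over a product, one variable being restricted to a
set of finite measure. -/
theorem integral_prod_indicator_add_mul_sub {A : Set E} (hA : MeasurableSet A)
    (hAf : volume A ≠ ∞) {g : E → ℝ} (hg : Integrable g) (hge : ∀ z, g (-z) = g z) :
    Integrable (fun z : E × E => (A.indicator 1 z.1 + A.indicator 1 z.2) * g (z.1 - z.2))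
      (volume.prod volume) ∧
    ∫ z : E × E, (A.indicator 1 z.1 + A.indicator 1 z.2) * g (z.1 - z.2) ∂(volume.prod volume) =
      2 * volume.real A * ∫ z, g z := by
  have h1A : Integrable (A.indicator (1 : E → ℝ)) :=
    (integrable_indicator_iff hA).2 (integrableOn_const hAf)
  have i2 : Integrable (fun z : E × E => A.indicator 1 z.2 * g (z.1 - z.2))
      (volume.prod volume) := h1A.convolution_integrand (ContinuousLinearMap.mul ℝ ℝ) hg
  have i1 : Integrable (fun z : E × E => A.indicator 1 z.1 * g (z.1 - z.2))
      (volume.prod volume) := by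
    refine i2.swap.congr (Eventually.of_forall fun z => ?_)
    simp only [Function.comp_apply, Prod.fst_swap, Prod.snd_swap]
    rw [← hge, neg_sub]
  have e2 : ∫ z : E × E, A.indicator 1 z.2 * g (z.1 - z.2) ∂(volume.prod volume) =
      volume.real A * ∫ z, g z := by
    rw [integral_prod_symm _ i2]
    simp only [integral_const_mul, integral_sub_right_eq_self (fun z => g z), integral_mul_const]
    rw [integral_indicator_one hA]
  have e1 : ∫ z : E × E, A.indicator 1 z.1 * g (z.1 - z.2) ∂(volume.prod volume) =
      volume.real A * ∫ z, g z := by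
    rw [← e2, ← integral_prod_swap]
    refine integral_congr_ae (Eventually.of_forall fun z => ?_)
    simp only [Prod.fst_swap, Prod.snd_swap]
    rw [← hge, neg_sub]
  simp only [add_mul]
  refine ⟨i1.add i2, ?_⟩
  rw [integral_add i1 i2, e1, e2]
  ring

/-- The nonlocal part of the energy estimate. -/
theorem exists_nonlocal_le (hn : 1 ≤ n) {p s L : ℝ} (hp : 1 < p) (hs0 : 0 < s) (hs1 : s < 1)
    (hL : 1 ≤ L) {K : E → E → ℝ} (hK : IsKernel p s L K) {M : ℝ} {m : ℕ}
    (hm : p ≤ (m + 1 : ℕ)) :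
    ∃ C : ℝ, 0 ≤ C ∧ ∀ (k : ℝ) (v : E → ℝ) (F : ℝ → ℝ) (ζ : E → ℝ) (N : ℝ), |k| ≤ M →
      Measurable v → (∀ x, |v x| ≤ M) → IsSmoothTruncation k F → Measurable ζ → (∀ x, 0 ≤ ζ x) →
      (∀ x, ζ x ≤ 1) → 1 ≤ N → (∀ x y, |ζ x - ζ y| ≤ N * ‖x - y‖) →
      volume {x | v x < k ∧ 0 < ζ x} ≠ ∞ →
      ∫ z : E × E, |v z.1 - v z.2| ^ (p - 2) * (v z.1 - v z.2) *
        (F (v z.1) * ζ z.1 ^ (m + 1) - F (v z.2) * ζ z.2 ^ (m + 1)) * K z.1 z.2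
          ∂(volume.prod volume) ≤ C * N ^ p * volume.real {x | v x < k ∧ 0 < ζ x} := by
  have hp0 : 0 < p := by linarith
  set g : E → ℝ := fun z => min 1 ‖z‖ ^ p / ‖z‖ ^ ((n : ℝ) + p * s) with hg
  have hgi : Integrable g := integrable_min_rpow_div (by simp) hn hp hs0 hs1
  have hg0 : ∀ z, 0 ≤ g z := fun z => by positivity
  -- The same number bounds `k - v` and the oscillation of `v` on the whole space; far interactions
  -- are controlled by it.
  set D := 2 * |M| with hD
  set C0 := (2 * |M|) ^ (p - 1) * D * 2 ^ p + (2 ^ (m + 1) * D * (m + 1 : ℕ)) ^ p with hC0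
  have hC00 : 0 ≤ C0 := by positivity
  refine ⟨C0 * L * 2 * ∫ z, g z, mul_nonneg (by positivity) (integral_nonneg hg0), ?_⟩
  intro k v F ζ N hkM hvm hvM hF hζm hζ0 hζ1 hN hζN hAf
  set A := {x | v x < k ∧ 0 < ζ x} with hA
  have hAm : MeasurableSet A :=
    (measurableSet_lt hvm measurable_const).inter (measurableSet_lt measurable_const hζm)
  obtain ⟨hi, he⟩ := integral_prod_indicator_add_mul_sub hAm hAf hgi (fun z => by simp [hg])
  have hM : ∀ x, |v x| ≤ |M| := fun x => (hvM x).trans (le_abs_self M)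
  have hkD : ∀ x, k - v x ≤ D := fun x => by
    have h1 := neg_abs_le (v x)
    have h2 := (le_abs_self k).trans (hkM.trans (le_abs_self M))
    have h3 := hM x
    rw [hD]; linarith
  have hN0 : 0 ≤ N := by linarith
  have hind : ∀ x, (if v x < k ∧ 0 < ζ x then (1 : ℝ) else 0) = A.indicator 1 x := fun x => by
    simp [indicator, hA]
  calc _ ≤ ∫ z : E × E, (C0 * L * N ^ p) *
        ((A.indicator 1 z.1 + A.indicator 1 z.2) * g (z.1 - z.2)) ∂(volume.prod volume) := by
        have hI0 : ∀ x, (0 : ℝ) ≤ A.indicator 1 x := fun x =>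
          indicator_nonneg (fun _ _ => zero_le_one) x
        -- Only an upper bound is needed, so the default value `0` of a divergent integral does no
        -- harm.
        refine integral_le_of_le_of_nonneg (hi.const_mul _) (fun z => ?_) (fun z => ?_)
        · exact mul_nonneg (by positivity) (mul_nonneg (add_nonneg (hI0 _) (hI0 _)) (hg0 _))
        · obtain ⟨x, y⟩ := z
          rcases eq_or_ne x y with rfl | hxy
          · simp only [sub_self, mul_zero, zero_mul]
            exact mul_nonneg (by positivity) (mul_nonneg (add_nonneg (hI0 _) (hI0 _)) (hg0 _))
          have hT : |v x - v y| ≤ 2 * |M| := by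
            have := abs_sub (v x) (v y)
            linarith [hM x, hM y]
          have h1 := nonlocal_integrand_le hp hm hF (by positivity : 0 ≤ D) (hkD x) (hkD y) hT
            (hζ0 x) (hζ1 x) (hζ0 y) (hζ1 y)
          rw [← hC0, hind, hind] at h1
          have hr : 0 < ‖x - y‖ := norm_pos_iff.2 (sub_ne_zero.2 hxy)
          have hK0 : 0 ≤ K x y := le_trans (by positivity) (hK.lower x y hxy)
          have hK1 := hK.upper x y hxy
          -- The oscillation of `ζ` is at most `1`, hence at most `N`; with the Lipschitz bound this
          -- yields the truncated kernel.
          have hΔ : |ζ x - ζ y| ^ p ≤ N ^ p * min 1 ‖x - y‖ ^ p := by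
            rw [← Real.mul_rpow hN0 (by positivity)]
            gcongr
            rw [mul_min_of_nonneg _ _ hN0, mul_one]
            refine le_min (le_trans ?_ hN) (hζN x y)
            rw [abs_le]
            constructor <;> linarith [hζ0 x, hζ1 x, hζ0 y, hζ1 y]
          have hII : (0 : ℝ) ≤ A.indicator 1 x + A.indicator 1 y := add_nonneg (hI0 _) (hI0 _)
          calc _ ≤ C0 * |ζ x - ζ y| ^ p * (A.indicator 1 x + A.indicator 1 y) * K x y := by
                gcongr
            _ ≤ C0 * (N ^ p * min 1 ‖x - y‖ ^ p) * (A.indicator 1 x + A.indicator 1 y) *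
                (L / ‖x - y‖ ^ ((n : ℝ) + p * s)) := by gcongr
            _ = _ := by rw [hg]; ring
    _ = _ := by
        rw [integral_const_mul, he]
        ring

/-- The energy estimate for truncations of supersolutions. -/
theorem exists_energy_le (hn : 1 ≤ n) {p s L : ℝ} (hp : 1 < p) (hs0 : 0 < s) (hs1 : s < 1)
    (hL : 1 ≤ L) {K : E → E → ℝ} (hK : IsKernel p s L K) {M : ℝ} {m : ℕ}
    (hm : p ≤ (m + 1 : ℕ)) :
    ∃ C : ℝ, 0 ≤ C ∧ ∀ (Ω Ω' : Opens E) (k : ℝ) (v : E → ℝ) (G : E → E) (F : ℝ → ℝ)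
      (ζ : E → ℝ) (N : ℝ), |k| ≤ M → Measurable v → (∀ x, |v x| ≤ M) → IsWeakSupersolution p K Ω v → CompactlyContained Ω' Ω →
      MemLp v (ENNReal.ofReal p) (volume.restrict Ω') →
      IsWeakGradient Ω' v G → MemLp G (ENNReal.ofReal p) (volume.restrict Ω') →
      IsSmoothTruncation k F → ContDiff ℝ (⊤ : ℕ∞) ζ → HasCompactSupport ζ → tsupport ζ ⊆ Ω' →
      (∀ x, 0 ≤ ζ x) → (∀ x, ζ x ≤ 1) → 1 ≤ N → (∀ x, ‖fderiv ℝ ζ x‖ ≤ N) →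
      (∀ x y, |ζ x - ζ y| ≤ N * ‖x - y‖) →
      ∃ Φ : E → E, HasZeroSobolevGradient p Ω' (fun x => F (v x) * ζ x ^ (m + 1)) Φ ∧
        (∀ x, ¬ (v x < k ∧ 0 < ζ x) → Φ x = 0) ∧
        ∫ x in (Ω' : Set E), ‖Φ x‖ ^ p ≤ C * N ^ p * volume.real {x | v x < k ∧ 0 < ζ x} := by
  have hp0 : 0 < p := by linarith
  obtain ⟨C1, hC10, hC1⟩ := exists_nonlocal_le hn hp hs0 hs1 hL hK (M := M) hm
  set D := 2 * |M| with hD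
  set c2 := (2 : ℝ) ^ p * (2 ^ p + 1) * (D * (m + 1 : ℕ)) ^ p with hc2
  have hc20 : 0 ≤ c2 := by positivity
  refine ⟨2 ^ (p + 1) * C1 + c2, by positivity, ?_⟩
  intro Ω Ω' k v G F ζ N hkM hvm hvM hsup hΩ' hv hG hGp hF hζs hζc hζΩ hζ0 hζ1 hN hζN hζL
  have hN0 : 0 ≤ N := by linarith
  have hηs : ContDiff ℝ (⊤ : ℕ∞) fun x => ζ x ^ (m + 1) := hζs.pow _
  have hsub : tsupport (fun x => ζ x ^ (m + 1)) ⊆ tsupport ζ := by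
    refine closure_mono fun x hx h => hx ?_
    simp [h]
  have hηc : HasCompactSupport fun x => ζ x ^ (m + 1) := hζc.mono' (subset_trans
    (subset_tsupport _) hsub)
  have hφ := hasZeroSobolevGradient_comp_mul hp hvm hv hG hGp hF.contDiff hF.abs_deriv_le
    hηs hηc (hsub.trans hζΩ)
  set Φ : E → E := fun x => (deriv F (v x) * ζ x ^ (m + 1)) • G x +
    F (v x) • ∇ (fun x => ζ x ^ (m + 1)) x with hΦ
  -- Since `p > 1` forces `m ≥ 1`, the gradient of `ζ^(m+1)` vanishes wherever `ζ` does, and `Φ`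
  -- vanishes everywhere off `A`.
  have hm0 : m ≠ 0 := by
    rintro rfl
    simp at hm
    linarith
  have hgr : ∀ x, ∇ (fun x => ζ x ^ (m + 1)) x = (((m + 1 : ℕ) : ℝ) * ζ x ^ m) • ∇ ζ x := by
    intro x
    refine HasGradientAt.gradient ?_
    rw [hasGradientAt_iff_hasFDerivAt]
    have h1 := ((hζs.differentiable (by simp) x).hasGradientAt.hasFDerivAt).pow (m + 1)
    refine h1.congr_fderiv ?_
    ext e
    simp
  have hΦ0 : ∀ x, ¬ (v x < k ∧ 0 < ζ x) → Φ x = 0 := by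
    intro x hx
    rcases not_and_or.1 hx with h | h
    · simp [hΦ, hF.eq_zero _ (not_lt.1 h), hF.deriv_eq_zero _ (not_lt.1 h)]
    · have : ζ x = 0 := le_antisymm (not_lt.1 h) (hζ0 x)
      simp [hΦ, hgr, this, hm0]
  have hΦp := hφ.memLp_grad
  refine ⟨Φ, hφ, hΦ0, ?_⟩
  set A := {x | v x < k ∧ 0 < ζ x} with hA
  have hAm : MeasurableSet A := (measurableSet_lt hvm measurable_const).inter
    (measurableSet_lt measurable_const hζs.continuous.measurable)
  have hAsub : A ⊆ tsupport ζ := fun x hx => subset_tsupport _ (ne_of_gt hx.2)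
  have hAf : volume A ≠ ∞ := ((measure_mono hAsub).trans_lt hζc.isCompact.measure_lt_top).ne
  have hM : ∀ x, |v x| ≤ |M| := fun x => (hvM x).trans (le_abs_self M)
  have hkD : ∀ x, k - v x ≤ D := fun x => by
    have h1 := neg_abs_le (v x)
    have h2 := (le_abs_self k).trans (hkM.trans (le_abs_self M))
    have h3 := hM x
    rw [hD]; linarith
  set X : E → ℝ := fun x => ‖G x‖ ^ (p - 2) * inner ℝ (G x) (Φ x) with hX
  have hpt : ∀ x, ‖Φ x‖ ^ p ≤ -2 ^ (p + 1) * X x + A.indicator (fun _ => c2 * N ^ p) x := by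
    intro x
    by_cases hx : x ∈ A
    · rw [indicator_of_mem hx]
      refine norm_rpow_le_neg_inner_add (d := -deriv F (v x)) (f := F (v x)) (z := ζ x)
        (Z := ∇ ζ x) hp hm (by positivity : 0 ≤ D) hN0 (by linarith [hF.deriv_nonpos (v x)])
        (by linarith [hF.neg_one_le_deriv (v x)]) (hF.nonneg _) ?_ hx.2 (hζ1 x) ?_ ?_
      · exact (hF.le_mul_deriv _).trans
          (mul_le_mul_of_nonneg_right (hkD x) (by linarith [hF.deriv_nonpos (v x)]))
      · rw [norm_gradient]; exact hζN x
      · simp only [hΦ, hgr, neg_neg, smul_smul]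
    · simp [indicator_of_notMem hx, hX, hΦ0 x hx, Real.zero_rpow hp0.ne']
  have hne0 : ENNReal.ofReal p ≠ 0 := by simpa using hp0
  have hΦi : Integrable (fun x => ‖Φ x‖ ^ p) (volume.restrict (Ω' : Set E)) := by
    have := hΦp.integrable_norm_rpow hne0 ENNReal.ofReal_ne_top
    rwa [ENNReal.toReal_ofReal hp0.le] at this
  have hGi : Integrable (fun x => ‖G x‖ ^ p) (volume.restrict (Ω' : Set E)) := by
    have := hGp.integrable_norm_rpow hne0 ENNReal.ofReal_ne_top
    rwa [ENNReal.toReal_ofReal hp0.le] at this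
  have hXi : Integrable X (volume.restrict (Ω' : Set E)) := by
    refine (hGi.add hΦi).mono' ?_ (Eventually.of_forall fun x => ?_)
    · exact ((hGp.1.norm.aemeasurable.pow_const _).mul
        (hGp.1.inner (𝕜 := ℝ) hΦp.1).aemeasurable).aestronglyMeasurable
    · refine le_trans ?_ (rpow_sub_one_mul_le_add hp (norm_nonneg (G x)) (norm_nonneg (Φ x)))
      rw [hX, norm_mul, Real.norm_of_nonneg (by positivity)]
      rcases (norm_nonneg (G x)).eq_or_lt with h | h
      · have : G x = 0 := norm_eq_zero.1 h.symm
        rw [this, inner_zero_left, norm_zero, norm_zero, mul_zero]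
        positivity
      · calc ‖G x‖ ^ (p - 2) * ‖inner ℝ (G x) (Φ x)‖
            ≤ ‖G x‖ ^ (p - 2) * (‖G x‖ * ‖Φ x‖) := by
              gcongr
              exact norm_inner_le_norm _ _
          _ = ‖G x‖ ^ (p - 2 + 1) * ‖Φ x‖ := by rw [Real.rpow_add_one h.ne']; ring
          _ = _ := by congr 2; ring
  have hIi : Integrable (A.indicator (fun _ => c2 * N ^ p)) (volume.restrict (Ω' : Set E)) :=
    ((integrable_indicator_iff hAm).2 (integrableOn_const hAf)).restrict
  have hIv : ∫ x in (Ω' : Set E), A.indicator (fun _ => c2 * N ^ p) x =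
      c2 * N ^ p * volume.real A := by
    rw [integral_indicator_const _ hAm, smul_eq_mul, measureReal_restrict_apply hAm,
      inter_eq_self_of_subset_left (hAsub.trans hζΩ), mul_comm]
  have hsup1 := hsup.nonneg Ω' hΩ' G hG _ (hφ.memSobolevZero hp)
    (fun x => mul_nonneg (hF.nonneg _) (pow_nonneg (hζ0 x) _)) Φ
    (hφ.isWeakGradient hp)
  have hnl := hC1 k v F ζ N hkM hvm hvM hF hζs.continuous.measurable hζ0 hζ1 hN hζL hAf
  -- Local plus nonlocal part is nonnegative, so the upper bound for the nonlocal part bounds `∫ X`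
  -- from below; `X` enters the pointwise estimate with a negative coefficient.
  have hXlow : -(C1 * N ^ p * volume.real A) ≤ ∫ x in (Ω' : Set E), X x := by linarith
  calc ∫ x in (Ω' : Set E), ‖Φ x‖ ^ p
      ≤ ∫ x in (Ω' : Set E), (-2 ^ (p + 1) * X x + A.indicator (fun _ => c2 * N ^ p) x) :=
        integral_mono hΦi ((hXi.const_mul _).add hIi) hpt
    _ = -2 ^ (p + 1) * (∫ x in (Ω' : Set E), X x) + c2 * N ^ p * volume.real A := by
        rw [integral_add (hXi.const_mul _) hIi, integral_const_mul, hIv]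
    _ ≤ -2 ^ (p + 1) * -(C1 * N ^ p * volume.real A) + c2 * N ^ p * volume.real A := by
        have h2 : (0 : ℝ) < 2 ^ (p + 1) := by positivity
        have := mul_le_mul_of_nonneg_left hXlow h2.le
        linarith
    _ = _ := by ring

end Energy

/-! ### Sobolev's inequality with small support. -/

section Sobolev

variable {n : ℕ}

local notation "E" => EuclideanSpace ℝ (Fin n)

/-- In dimension one, a compactly supported function is bounded by the `L^1` norm of its
derivative. -/
theorem enorm_le_lintegral_enorm_fderiv_fin_one {u : EuclideanSpace ℝ (Fin 1) → ℝ}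
    (hu : ContDiff ℝ 1 u) (huc : HasCompactSupport u) (x : EuclideanSpace ℝ (Fin 1)) :
    ‖u x‖ₑ ≤ ∫⁻ y, ‖fderiv ℝ u y‖ₑ := by
  let ι : ℝ ≃ₗᵢ[ℝ] EuclideanSpace ℝ (Fin 1) := (OrthonormalBasis.singleton (Fin 1) ℝ).repr
  have hw : ContDiff ℝ 1 (u ∘ ι) := hu.comp ι.contDiff
  have hwc : HasCompactSupport (u ∘ ι) := huc.comp_homeomorph ι.toHomeomorph
  have h1 := HasCompactSupport.enorm_le_lintegral_Ici_deriv hw hwc (ι.symm x)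
  rw [Function.comp_apply, ι.apply_symm_apply] at h1
  refine h1.trans ((lintegral_mono' Measure.restrict_le_self le_rfl).trans ?_)
  have h2 : ∫⁻ y, ‖fderiv ℝ u y‖ₑ = ∫⁻ t, ‖fderiv ℝ u (ι t)‖ₑ :=
    (ι.measurePreserving.lintegral_comp
      (hu.continuous_fderiv one_ne_zero).measurable.enorm).symm
  rw [h2]
  refine lintegral_mono fun t => ?_
  have h3 : HasDerivAt (u ∘ ι) (fderiv ℝ u (ι t) (ι 1)) t := by
    have h4 := ((hu.differentiable one_ne_zero) (ι t)).hasFDerivAt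
    have h5 : HasDerivAt ι (ι 1) t := by
      have := ι.toContinuousLinearEquiv.toContinuousLinearMap.hasDerivAt (x := t)
      exact this
    exact h4.comp_hasDerivAt t h5
  rw [h3.deriv]
  refine ((fderiv ℝ u (ι t)).le_opENorm (ι 1)).trans ?_
  have : ‖ι 1‖ₑ = 1 := by rw [ι.enorm_map]; simp
  rw [this, mul_one]

/-- The endpoint Sobolev inequality, in every dimension. -/
theorem exists_sobolev_exponent (hn : 1 ≤ n) : ∃ (q : ℝ≥0∞) (C : NNReal), 1 ≤ q ∧
    1 / (1 : ℝ≥0∞).toReal - 1 / q.toReal = 1 / (n : ℝ) ∧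
    ∀ u : E → ℝ, ContDiff ℝ 1 u → HasCompactSupport u →
      eLpNorm u q volume ≤ C * eLpNorm (∇ u) 1 volume := by
  have hgr : ∀ u : E → ℝ, eLpNorm (∇ u) 1 volume = eLpNorm (fderiv ℝ u) 1 volume := fun u =>
    eLpNorm_congr_norm_ae (Eventually.of_forall fun x => norm_gradient x)
  -- For `n = 1` the exponent is `q = ∞`, and `1 / q.toReal = 1 / 0 = 0` makes the exponent relation
  -- read `1 - 0 = 1`. For `n ≥ 2` it is `n/(n-1)`.
  rcases hn.eq_or_lt with rfl | hn2
  · refine ⟨⊤, 1, le_top, by simp, fun u hu huc => ?_⟩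
    rw [hgr, ENNReal.coe_one, one_mul, eLpNorm_one_eq_lintegral_enorm, eLpNorm_exponent_top]
    exact eLpNormEssSup_le_of_ae_enorm_bound
      (Eventually.of_forall (enorm_le_lintegral_enorm_fderiv_fin_one hu huc))
  · have hn1 : (1 : NNReal) < n := by exact_mod_cast hn2
    have hc := NNReal.HolderConjugate.conjExponent hn1
    set q := NNReal.conjExponent (n : NNReal)
    have hq1 : 1 < q := hc.symm.lt
    refine ⟨q, eLpNormLESNormFDerivOneConst (volume : Measure E) q, by exact_mod_cast hq1.le, ?_,
      fun u hu huc => ?_⟩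
    · have h1 := hc.coe.inv_add_inv_eq_one
      simp only [NNReal.coe_natCast] at h1
      simp only [ENNReal.toReal_one, ENNReal.coe_toReal, one_div, inv_one]
      linarith
    · rw [hgr]
      exact eLpNorm_le_eLpNorm_fderiv_one volume hu huc (by simpa using hc)

/-- Approximating gradients converge in `L^1` because `Ω` has finite measure. Along an almost
everywhere convergent subsequence, lower semicontinuity of the norm handles the left side, including
`q = ∞`. -/
theorem HasZeroSobolevGradient.eLpNorm_le {p : ℝ} (hp : 1 < p) {Ω : Opens E} {φ : E → ℝ}
    {Φ : E → E} (h : HasZeroSobolevGradient p Ω φ Φ) (hΩ : volume (Ω : Set E) ≠ ∞) {q : ℝ≥0∞}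
    {C : NNReal} (hC : ∀ u : E → ℝ, ContDiff ℝ 1 u → HasCompactSupport u →
      eLpNorm u q volume ≤ C * eLpNorm (∇ u) 1 volume) :
    eLpNorm φ q (volume.restrict Ω) ≤ C * eLpNorm Φ 1 (volume.restrict Ω) := by
  have hp1 : 1 ≤ ENNReal.ofReal p := by
    rw [← ENNReal.ofReal_one]; exact ENNReal.ofReal_le_ofReal hp.le
  obtain ⟨ψ, h1, h2⟩ := h.exists_testFunction
  have hψm : ∀ k, AEStronglyMeasurable (ψ k) (volume.restrict (Ω : Set E)) := fun k =>
    (ψ k).continuous.aestronglyMeasurable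
  have hψm' : ∀ k, AEStronglyMeasurable (∇ (ψ k)) (volume.restrict (Ω : Set E)) := fun k =>
    (TestFunction.continuous_grad (ψ k)).aestronglyMeasurable
  obtain ⟨ns, hns, hae⟩ := (tendstoInMeasure_of_tendsto_eLpNorm
    (by simpa using (by linarith : 0 < p)) hψm h.memLp.1 h1).exists_seq_tendsto_ae
  have h3 : Tendsto (fun k => eLpNorm (fun x => ∇ (ψ k) x - Φ x) 1 (volume.restrict Ω))
      atTop (𝓝 0) := by
    have hfin : (volume.restrict (Ω : Set E)) univ ^
        (1 / (1 : ℝ≥0∞).toReal - 1 / (ENNReal.ofReal p).toReal) ≠ ∞ := by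
      refine ENNReal.rpow_ne_top_of_nonneg ?_ (by simpa using hΩ)
      rw [ENNReal.toReal_one, ENNReal.toReal_ofReal (by linarith), div_one, sub_nonneg,
        div_le_one (by linarith)]
      exact hp.le
    have h0 := ENNReal.Tendsto.mul_const h2 (Or.inr hfin)
    rw [zero_mul] at h0
    exact tendsto_of_tendsto_of_tendsto_of_le_of_le tendsto_const_nhds h0 (fun _ => zero_le)
      fun k => eLpNorm_le_eLpNorm_mul_rpow_measure_univ hp1 ((hψm' k).sub h.memLp_grad.1)
  have hbound : ∀ k, eLpNorm (ψ k) q (volume.restrict Ω) ≤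
      C * (eLpNorm (fun x => ∇ (ψ k) x - Φ x) 1 (volume.restrict Ω) +
        eLpNorm Φ 1 (volume.restrict Ω)) := by
    intro k
    refine (eLpNorm_restrict_le _ _ _ _).trans ((hC _ (TestFunction.contDiff_one (ψ k))
      (ψ k).hasCompactSupport).trans ?_)
    gcongr
    have hs : Function.support (∇ (ψ k)) ⊆ Ω := fun x hx => by
      by_contra hxΩ
      exact hx (gradient_eq_zero_of_notMem_tsupport fun hh => hxΩ ((ψ k).tsupport_subset hh))
    rw [← eLpNorm_restrict_eq_of_support_subset hs]
    have : ∇ (ψ k) = (fun x => ∇ (ψ k) x - Φ x) + Φ := by ext1 x; simp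
    conv_lhs => rw [this]
    exact eLpNorm_add_le ((hψm' k).sub h.memLp_grad.1) h.memLp_grad.1 le_rfl
  have hlim : Tendsto (fun k => (C : ℝ≥0∞) * (eLpNorm (fun x => ∇ (ψ (ns k)) x - Φ x) 1
      (volume.restrict Ω) + eLpNorm Φ 1 (volume.restrict Ω))) atTop
      (𝓝 (C * eLpNorm Φ 1 (volume.restrict Ω))) := by
    have := ENNReal.Tendsto.const_mul (a := (C : ℝ≥0∞))
      ((h3.comp hns.tendsto_atTop).add_const (eLpNorm Φ 1 (volume.restrict Ω)))
      (Or.inr ENNReal.coe_ne_top)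
    simpa using this
  calc eLpNorm φ q (volume.restrict Ω)
      ≤ atTop.liminf fun k => eLpNorm (ψ (ns k)) q (volume.restrict Ω) :=
        Lp.eLpNorm_lim_le_liminf_eLpNorm (fun k => hψm (ns k)) φ hae
    _ ≤ atTop.liminf fun k => (C : ℝ≥0∞) * (eLpNorm (fun x => ∇ (ψ (ns k)) x - Φ x) 1
      (volume.restrict Ω) + eLpNorm Φ 1 (volume.restrict Ω)) :=
        liminf_le_liminf (Eventually.of_forall fun k => hbound (ns k))
    _ = _ := hlim.liminf_eq

/-- Sobolev's inequality for functions that vanish outside a set of small measure. -/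
theorem exists_integral_le_of_eq_zero (hn : 1 ≤ n) : ∃ C : ℝ, 0 ≤ C ∧
    ∀ (p : ℝ) (Ω : Opens E) (φ : E → ℝ) (Φ : E → E) (A : Set E), 1 < p →
      HasZeroSobolevGradient p Ω φ Φ → volume (Ω : Set E) ≠ ∞ → MeasurableSet A → A ⊆ Ω →
      (∀ x ∉ A, φ x = 0) → (∀ x ∉ A, Φ x = 0) →
      ∫ x in (Ω : Set E), ‖φ x‖ ≤ C * volume.real A ^ (1 / (n : ℝ) + (1 - 1 / p)) *
        (∫ x in (Ω : Set E), ‖Φ x‖ ^ p) ^ (1 / p) := by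
  obtain ⟨q, C, hq1, hq, hC⟩ := exists_sobolev_exponent hn
  refine ⟨C, C.2, fun p Ω φ Φ A hp h hΩ hA hAΩ hφ hΦ => ?_⟩
  have hp0 : 0 < p := by linarith
  have hp1 : 1 ≤ ENNReal.ofReal p := by
    rw [← ENNReal.ofReal_one]; exact ENNReal.ofReal_le_ofReal hp.le
  have hAf : volume A ≠ ∞ := ((measure_mono hAΩ).trans_lt hΩ.lt_top).ne
  have hrest : ∀ {H : Type} [NormedAddCommGroup H] (f : E → H) (r : ℝ≥0∞), (∀ x ∉ A, f x = 0) →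
      eLpNorm f r (volume.restrict (Ω : Set E)) = eLpNorm f r (volume.restrict A) := by
    intro H _ f r hf
    have hs : Function.support f ⊆ A := fun x hx => by
      by_contra hxA; exact hx (hf x hxA)
    rw [eLpNorm_restrict_eq_of_support_subset hs,
      eLpNorm_restrict_eq_of_support_subset (hs.trans hAΩ)]
  have hle : volume.restrict A ≤ volume.restrict (Ω : Set E) := Measure.restrict_mono hAΩ le_rfl
  -- Hölder is applied on `A` rather than on `Ω`: here it gains the power `1/n`, and for the
  -- gradient below the power `1 - 1/p`.
  have e1 : eLpNorm φ 1 (volume.restrict Ω) ≤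
      eLpNorm φ q (volume.restrict Ω) * volume A ^ (1 / (n : ℝ)) := by
    rw [hrest φ 1 hφ, hrest φ q hφ, ← hq]
    simpa using eLpNorm_le_eLpNorm_mul_rpow_measure_univ hq1 (h.memLp.1.mono_measure hle)
  have e2 := h.eLpNorm_le hp hΩ hC
  have e3 : eLpNorm Φ 1 (volume.restrict Ω) ≤
      eLpNorm Φ (ENNReal.ofReal p) (volume.restrict Ω) * volume A ^ (1 - 1 / p) := by
    rw [hrest Φ 1 hΦ, hrest Φ _ hΦ]
    simpa [ENNReal.toReal_ofReal hp0.le] using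
      eLpNorm_le_eLpNorm_mul_rpow_measure_univ hp1 (h.memLp_grad.1.mono_measure hle)
  have hexp : (0 : ℝ) ≤ 1 - 1 / p := by
    rw [sub_nonneg, div_le_one hp0]; exact hp.le
  have e4 : eLpNorm φ 1 (volume.restrict Ω) ≤ C * volume A ^ (1 / (n : ℝ) + (1 - 1 / p)) *
      eLpNorm Φ (ENNReal.ofReal p) (volume.restrict Ω) := by
    calc eLpNorm φ 1 (volume.restrict Ω) ≤ (C * (eLpNorm Φ (ENNReal.ofReal p)
          (volume.restrict Ω) * volume A ^ (1 - 1 / p))) * volume A ^ (1 / (n : ℝ)) := by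
          refine e1.trans ?_
          gcongr
          refine e2.trans ?_
          gcongr
      _ = _ := by
          rw [ENNReal.rpow_add_of_nonneg _ _ (by positivity) hexp]
          ring
  have hφ1 : ∫ x in (Ω : Set E), ‖φ x‖ = (eLpNorm φ 1 (volume.restrict Ω)).toReal := by
    rw [eLpNorm_one_eq_lintegral_enorm, integral_norm_eq_lintegral_enorm h.memLp.1]
  have hne0 : ENNReal.ofReal p ≠ 0 := by simpa using hp0
  have hΦ1 : (∫ x in (Ω : Set E), ‖Φ x‖ ^ p) ^ (1 / p) =
      (eLpNorm Φ (ENNReal.ofReal p) (volume.restrict Ω)).toReal := by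
    rw [h.memLp_grad.eLpNorm_eq_integral_rpow_norm hne0 ENNReal.ofReal_ne_top,
      ENNReal.toReal_ofReal hp0.le, ENNReal.toReal_ofReal (by positivity), one_div]
  rw [hφ1, hΦ1, measureReal_def, ENNReal.toReal_rpow]
  have htop : C * volume A ^ (1 / (n : ℝ) + (1 - 1 / p)) *
      eLpNorm Φ (ENNReal.ofReal p) (volume.restrict Ω) ≠ ∞ :=
    ENNReal.mul_ne_top (ENNReal.mul_ne_top ENNReal.coe_ne_top
      (ENNReal.rpow_ne_top_of_nonneg (by positivity) hAf)) h.memLp_grad.2.ne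
  have := ENNReal.toReal_mono htop e4
  rwa [ENNReal.toReal_mul, ENNReal.toReal_mul, ENNReal.coe_toReal] at this

end Sobolev

/-! ### De Giorgi iteration. -/

section DeGiorgi

variable {n : ℕ}

local notation "E" => EuclideanSpace ℝ (Fin n)

/-- One step of De Giorgi's iteration. -/
theorem exists_measure_sublevel_le (hn : 1 ≤ n) {p s L : ℝ} (hp : 1 < p) (hs0 : 0 < s)
    (hs1 : s < 1) (hL : 1 ≤ L) {K : E → E → ℝ} (hK : IsKernel p s L K) (M : ℝ) :
    ∃ C : ℝ, 0 < C ∧ ∀ (Ω : Opens E) (v : E → ℝ), Measurable v → (∀ x, |v x| ≤ M) →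
      IsWeakSupersolution p K Ω v → ∀ (k δ : ℝ) (x₀ : E) (r' r ρ : ℝ), |k| ≤ M → 0 < δ → 0 < r' →
      r' < r → r < ρ → r - r' ≤ 1 → closedBall x₀ ρ ⊆ Ω →
      volume.real ({x | v x < k - δ / 2} ∩ ball x₀ r') ≤
        C / (δ * (r - r')) * volume.real ({x | v x < k} ∩ ball x₀ r) ^ (1 + 1 / (n : ℝ)) := by
  have hp0 : 0 < p := by linarith
  obtain ⟨m, hm⟩ : ∃ m : ℕ, p ≤ (m + 1 : ℕ) := by
    obtain ⟨m, hm⟩ := exists_nat_ge p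
    exact ⟨m, hm.trans (by push_cast; linarith)⟩
  obtain ⟨Ce, hCe0, hCe⟩ := exists_energy_le hn hp hs0 hs1 hL hK (M := M) hm
  obtain ⟨Cs, hCs0, hCs⟩ := exists_integral_le_of_eq_zero hn
  obtain ⟨Cc, hCc0, hCc⟩ := exists_cutoff E
  obtain ⟨c, hc0, hc⟩ := exists_isSmoothTruncation
  -- The added `1` keeps the constant positive even if `Cs` or `Ce` vanishes.
  refine ⟨(Cs * Ce ^ (1 / p) * (Cc + 1) + 1) / c, by positivity, ?_⟩
  intro Ω v hvm hvM hsup k δ x₀ r' r ρ hkM hδ hr' hr hρ hrr hball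
  obtain ⟨F, hF, hFc⟩ := hc k δ hδ
  obtain ⟨ζ, hζs, hζ0, hζ1, hζ_one, hζsupp, hζN, hζL⟩ := hCc x₀ r' r hr' hr
  have hrr0 : 0 < r - r' := by linarith
  -- Enlarging `Cc` by `1` ensures `1 ≤ N`, because `r - r' ≤ 1`.
  set N := (Cc + 1) / (r - r') with hN
  have hCN : Cc / (r - r') ≤ N := by rw [hN]; gcongr; linarith
  have hN1 : 1 ≤ N := by rw [hN, one_le_div hrr0]; linarith
  let Ω' : Opens E := ⟨ball x₀ ρ, isOpen_ball⟩
  have hΩ' : CompactlyContained Ω' Ω := by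
    have : closure (ball x₀ ρ) ⊆ closedBall x₀ ρ := closure_ball_subset_closedBall
    exact ⟨(isCompact_closedBall x₀ ρ).of_isClosed_subset isClosed_closure this, this.trans hball⟩
  obtain ⟨hv, G, hG, hGp⟩ := hsup.memSobolevLoc Ω' hΩ'
  have hζts : tsupport ζ ⊆ closedBall x₀ r :=
    (closure_mono hζsupp).trans closure_ball_subset_closedBall
  have hζc : HasCompactSupport ζ :=
    (isCompact_closedBall x₀ r).of_isClosed_subset (isClosed_tsupport _) hζts
  have hζΩ : tsupport ζ ⊆ Ω' := hζts.trans (closedBall_subset_ball hρ)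
  obtain ⟨Φ, hφ, hΦ0, hΦe⟩ := hCe Ω Ω' k v G F ζ N hkM hvm hvM hsup hΩ' hv hG hGp hF hζs hζc hζΩ
    hζ0 hζ1 hN1 (fun x => (hζN x).trans hCN)
    (fun x y => (hζL x y).trans (mul_le_mul_of_nonneg_right hCN (norm_nonneg _)))
  set A := {x | v x < k ∧ 0 < ζ x} with hA
  have hAm : MeasurableSet A := (measurableSet_lt hvm measurable_const).inter
    (measurableSet_lt measurable_const hζs.continuous.measurable)
  have hAball : A ⊆ {x | v x < k} ∩ ball x₀ r := fun x hx =>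
    ⟨hx.1, hζsupp (ne_of_gt hx.2)⟩
  have hAΩ : A ⊆ Ω' := fun x hx => ball_subset_ball hρ.le (hAball hx).2
  have hΩf : volume (Ω' : Set E) ≠ ∞ := measure_ball_lt_top.ne
  set φ : E → ℝ := fun x => F (v x) * ζ x ^ (m + 1) with hφd
  have hφ0 : ∀ x, 0 ≤ φ x := fun x => mul_nonneg (hF.nonneg _) (pow_nonneg (hζ0 x) _)
  have hφA : ∀ x ∉ A, φ x = 0 := by
    intro x hx
    rcases not_and_or.1 hx with h | h
    · simp [hφd, hF.eq_zero _ (not_lt.1 h)]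
    · simp [hφd, le_antisymm (not_lt.1 h) (hζ0 x)]
  have hS := hCs p Ω' φ Φ A hp hφ hΩf hAm hAΩ hφA hΦ0
  set a := volume.real A with ha
  have ha0 : 0 ≤ a := measureReal_nonneg
  set B := {x | v x < k - δ / 2} ∩ ball x₀ r' with hB
  have hBm : MeasurableSet B := (measurableSet_lt hvm measurable_const).inter measurableSet_ball
  have hBΩ : B ⊆ Ω' := fun x hx => ball_subset_ball (hr.trans hρ).le hx.2
  have hBf : volume B ≠ ∞ := ((measure_mono hBΩ).trans_lt hΩf.lt_top).ne
  have hφi : Integrable φ (volume.restrict (Ω' : Set E)) := by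
    have : IsFiniteMeasure (volume.restrict (Ω' : Set E)) := ⟨by simpa using hΩf.lt_top⟩
    exact hφ.memLp.integrable (by rw [← ENNReal.ofReal_one]; exact ENNReal.ofReal_le_ofReal hp.le)
  have hlow : c * δ * volume.real B ≤ ∫ x in (Ω' : Set E), ‖φ x‖ := by
    have e1 : ∫ x in (Ω' : Set E), B.indicator (fun _ => c * δ) x = c * δ * volume.real B := by
      rw [integral_indicator_const _ hBm, smul_eq_mul, measureReal_restrict_apply hBm,
        inter_eq_self_of_subset_left hBΩ, mul_comm]
    rw [← e1]
    refine integral_mono ((integrable_indicator_iff hBm).2 (integrableOn_const hBf)).restrict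
      hφi.norm fun x => ?_
    by_cases hx : x ∈ B
    · rw [indicator_of_mem hx, Real.norm_of_nonneg (hφ0 x)]
      simp only [hφd, hζ_one x hx.2, one_pow, mul_one]
      exact hFc _ hx.1.le
    · rw [indicator_of_notMem hx]; exact norm_nonneg _
  have hn0 : (0 : ℝ) < n := by exact_mod_cast hn
  -- The energy contributes `(N^p a)^(1/p)`, so the powers of `a` add up to `1 + 1/n` and `N`
  -- appears linearly.
  have hup : ∫ x in (Ω' : Set E), ‖φ x‖ ≤ Cs * Ce ^ (1 / p) * N * a ^ (1 + 1 / (n : ℝ)) := by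
    calc _ ≤ Cs * a ^ (1 / (n : ℝ) + (1 - 1 / p)) * (Ce * N ^ p * a) ^ (1 / p) := by
          refine hS.trans ?_
          gcongr
      _ = Cs * Ce ^ (1 / p) * N * (a ^ (1 / (n : ℝ) + (1 - 1 / p)) * a ^ (1 / p)) := by
          rw [Real.mul_rpow (by positivity) ha0, Real.mul_rpow hCe0 (by positivity),
            ← Real.rpow_mul (by positivity), mul_one_div_cancel hp0.ne', Real.rpow_one]
          ring
      _ = _ := by
          have h1 : (0 : ℝ) ≤ 1 - 1 / p := by
            rw [sub_nonneg, div_le_one hp0]; exact hp.le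
          rw [← Real.rpow_add_of_nonneg ha0 (by positivity) (by positivity)]
          congr 2
          ring
  set b := volume.real ({x | v x < k} ∩ ball x₀ r)
  have hab : a ≤ b := measureReal_mono hAball
    ((measure_mono inter_subset_right).trans_lt measure_ball_lt_top).ne
  have hfin : c * δ * volume.real B ≤
      (Cs * Ce ^ (1 / p) * (Cc + 1) + 1) / (r - r') * b ^ (1 + 1 / (n : ℝ)) := by
    calc _ ≤ Cs * Ce ^ (1 / p) * N * a ^ (1 + 1 / (n : ℝ)) := hlow.trans hup
      _ = Cs * Ce ^ (1 / p) * (Cc + 1) / (r - r') * a ^ (1 + 1 / (n : ℝ)) := by rw [hN]; ring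
      _ ≤ _ := by
          gcongr
          linarith
  set T := Cs * Ce ^ (1 / p) * (Cc + 1) + 1
  have e2 : T / c / (δ * (r - r')) * b ^ (1 + 1 / (n : ℝ)) =
      (T / (r - r') * b ^ (1 + 1 / (n : ℝ))) / (c * δ) := by
    field_simp
  rw [e2, le_div_iff₀ (by positivity), mul_comm]
  exact hfin

/-- De Giorgi's lemma: a supersolution that is mostly at least `k` in a small ball is at least
`k - d` in the ball of half the radius. -/
theorem exists_deGiorgi (hn : 1 ≤ n) {p s L : ℝ} (hp : 1 < p) (hs0 : 0 < s)
    (hs1 : s < 1) (hL : 1 ≤ L) {K : E → E → ℝ} (hK : IsKernel p s L K) {M k d : ℝ}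
    (hk : |k| ≤ M) (hd : 0 < d) (hkd : |k - d| ≤ M) :
    ∃ ν : ℝ, 0 < ν ∧ ∀ (Ω : Opens E) (v : E → ℝ), Measurable v → (∀ x, |v x| ≤ M) →
      IsWeakSupersolution p K Ω v → ∀ (x₀ : E) (r ρ : ℝ), 0 < r → r ≤ 1 → r < ρ →
      closedBall x₀ ρ ⊆ Ω → volume.real ({x | v x < k} ∩ ball x₀ r) ≤ ν * r ^ n →
      volume ({x | v x < k - d} ∩ ball x₀ (r / 2)) = 0 := by
  obtain ⟨C, hC0, hC⟩ := exists_measure_sublevel_le hn hp hs0 hs1 hL hK M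
  have hn0 : (0 : ℝ) < n := by exact_mod_cast hn
  -- The level gap `d 2^(-j)` and the radius gap `(r/4) 2^(-j)` contribute the factor `(4/d) 4^j`,
  -- apart from `1/r`.
  obtain ⟨ν, hν0, hν⟩ := exists_tendsto_zero_of_le_mul_pow (C := 4 * C / d) (b := 4)
    (α := 1 / (n : ℝ)) (by positivity) (by norm_num) (by positivity)
  refine ⟨ν, hν0, fun Ω v hvm hvM hsup x₀ r ρ hr hr1 hρ hball hsmall => ?_⟩
  -- Levels fall from `k` towards `k - d` and radii from `r` towards `r/2`; `Y` is normalized by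
  -- `r^n`, making the recursion scale invariant.
  set κ : ℕ → ℝ := fun j => k - d * (1 - (1 / 2) ^ j) with hκ
  set R : ℕ → ℝ := fun j => r / 2 * (1 + (1 / 2) ^ j) with hR
  set Y : ℕ → ℝ := fun j => volume.real ({x | v x < κ j} ∩ ball x₀ (R j)) / r ^ n with hY
  have hhalf0 : ∀ j : ℕ, (0 : ℝ) < (1 / 2) ^ j := fun j => by positivity
  have hhalf1 : ∀ j : ℕ, (1 / 2 : ℝ) ^ j ≤ 1 := fun j =>
    pow_le_one₀ (by norm_num) (by norm_num)
  have hκM : ∀ j, |κ j| ≤ M := by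
    intro j
    have h1 := abs_le.1 hk
    have h2 := abs_le.1 hkd
    have h3 : d * (1 - (1 / 2) ^ j) ≤ d := by nlinarith [hhalf0 j]
    have h4 : 0 ≤ d * (1 - (1 / 2) ^ j) := mul_nonneg hd.le (by linarith [hhalf1 j])
    rw [abs_le]
    constructor <;> simp only [hκ] <;> linarith
  have hstep : ∀ j, Y (j + 1) ≤ 4 * C / d * 4 ^ j * Y j ^ (1 + 1 / (n : ℝ)) := by
    intro j
    have hR0 : 0 < R (j + 1) := by positivity
    have hsub : R j - R (j + 1) = r / 4 * (1 / 2) ^ j := by simp only [hR, pow_succ]; ring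
    have hlt : R (j + 1) < R j := by
      have : 0 < r / 4 * (1 / 2) ^ j := by positivity
      linarith
    have hRr : R j ≤ r := by simp only [hR]; nlinarith [hhalf1 j]
    have h1 := hC Ω v hvm hvM hsup (κ j) (d * (1 / 2) ^ j) x₀ (R (j + 1)) (R j) ρ (hκM j)
      (by positivity) hR0 hlt (hRr.trans_lt hρ) (by linarith) hball
    have hκs : κ j - d * (1 / 2) ^ j / 2 = κ (j + 1) := by simp only [hκ, pow_succ]; ring
    rw [hκs, hsub] at h1
    set y := volume.real ({x | v x < κ j} ∩ ball x₀ (R j)) with hy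
    have hy0 : 0 ≤ y := measureReal_nonneg
    have hrn : (0 : ℝ) < r ^ n := by positivity
    -- The additional factor `(r^n)^(1/n) = r` cancels the `1/r` from the radius gap; this is why
    -- `ν` does not depend on `r`.
    have h2 : y ^ (1 + 1 / (n : ℝ)) = r ^ n * r * Y j ^ (1 + 1 / (n : ℝ)) := by
      have e1 : y = r ^ n * Y j := by simp only [hY]; field_simp; exact hy
      have hYj : 0 ≤ Y j := by positivity
      rw [e1, Real.mul_rpow hrn.le hYj, Real.rpow_add hrn, Real.rpow_one, one_div,
        Real.pow_rpow_inv_natCast hr.le (by omega)]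
    rw [h2] at h1
    have h3 : C / (d * (1 / 2) ^ j * (r / 4 * (1 / 2) ^ j)) *
        (r ^ n * r * Y j ^ (1 + 1 / (n : ℝ))) =
        (4 * C / d * 4 ^ j * Y j ^ (1 + 1 / (n : ℝ))) * r ^ n := by
      have : (4 : ℝ) ^ j = (((1 / 2) ^ j) * ((1 / 2) ^ j))⁻¹ := by
        rw [← mul_pow, ← inv_pow]; norm_num
      rw [this]
      field_simp
    rw [h3] at h1
    exact (div_le_iff₀ hrn).2 h1
  have hY0 : Y 0 ≤ ν := by
    have : Y 0 = volume.real ({x | v x < k} ∩ ball x₀ r) / r ^ n := by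
      simp only [hY, hκ, hR, pow_zero, sub_self, mul_zero, sub_zero]
      norm_num
    rw [this, div_le_iff₀ (by positivity)]
    exact hsmall
  have hlim := hν Y (fun j => by positivity) hstep hY0
  have hle : ∀ j, volume.real ({x | v x < k - d} ∩ ball x₀ (r / 2)) / r ^ n ≤ Y j := by
    intro j
    refine div_le_div_of_nonneg_right (measureReal_mono ?_
      ((measure_mono inter_subset_right).trans_lt measure_ball_lt_top).ne) (by positivity)
    refine inter_subset_inter (fun x hx => ?_) (ball_subset_ball ?_)
    · have hx' : v x < k - d := hx
      refine hx'.trans_le ?_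
      simp only [hκ]
      nlinarith [hhalf0 j]
    · simp only [hR]
      nlinarith [hhalf0 j]
  have h0 := ge_of_tendsto' hlim hle
  have hrn : (0 : ℝ) < r ^ n := by positivity
  have h1 : volume.real ({x | v x < k - d} ∩ ball x₀ (r / 2)) = 0 := by
    rw [div_le_iff₀ hrn, zero_mul] at h0
    exact le_antisymm h0 measureReal_nonneg
  rwa [measureReal_eq_zero_iff
    ((measure_mono inter_subset_right).trans_lt measure_ball_lt_top).ne] at h1

end DeGiorgi

/-! ### Passing to a bounded measurable representative. -/

section Congruence

variable {n : ℕ}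

local notation "E" => EuclideanSpace ℝ (Fin n)

theorem IsWeakGradient.congr {Ω : Opens E} {u v : E → ℝ} {G : E → E} (h : IsWeakGradient Ω u G)
    (huv : u =ᵐ[volume] v) : IsWeakGradient Ω v G := by
  refine ⟨h.locallyIntegrableOn.congr (ae_restrict_of_ae huv), h.locallyIntegrableOn_grad,
    fun ψ => ?_⟩
  rw [← h.integral_eq ψ]
  refine integral_congr_ae ?_
  filter_upwards [ae_restrict_of_ae huv] with x hx
  rw [hx]

/-- Changing `u` on a null set affects the double integrand only at pairs with a coordinate in that
set, which form a null set of the product. The estimates above can thus be applied to an everywhere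
bounded measurable representative. -/
theorem IsWeakSupersolution.congr {p : ℝ} {K : E → E → ℝ} {Ω : Opens E} {u v : E → ℝ}
    (h : IsWeakSupersolution p K Ω u) (huv : u =ᵐ[volume] v) : IsWeakSupersolution p K Ω v := by
  refine ⟨(memLp_congr_ae huv).1 h.memLp_top, fun Ω' hΩ' => ?_, fun Ω' hΩ' G hG φ hφ hφ0 Φ hΦ => ?_⟩
  · obtain ⟨h1, G, hG, hGp⟩ := h.memSobolevLoc Ω' hΩ'
    exact ⟨(memLp_congr_ae (ae_restrict_of_ae huv)).1 h1, G, hG.congr huv, hGp⟩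
  · have h1 := h.nonneg Ω' hΩ' G (hG.congr huv.symm) φ hφ hφ0 Φ hΦ
    refine h1.trans_eq ?_
    congr 1
    refine integral_congr_ae ?_
    filter_upwards [Measure.quasiMeasurePreserving_fst.ae huv,
      Measure.quasiMeasurePreserving_snd.ae huv] with z hz1 hz2
    rw [hz1, hz2]

/-- An essentially bounded function has a measurable representative that is bounded everywhere. -/
theorem exists_measurable_bounded_ae_eq {α : Type*} [MeasurableSpace α] {μ : Measure α}
    {u : α → ℝ} (hu : MemLp u ⊤ μ) :
    ∃ (v : α → ℝ) (M : ℝ), Measurable v ∧ (∀ x, |v x| ≤ M) ∧ u =ᵐ[μ] v := by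
  obtain ⟨w, hw, huw⟩ := hu.1.aemeasurable
  set M := (eLpNorm u ⊤ μ).toReal with hM
  have hM0 : 0 ≤ M := ENNReal.toReal_nonneg
  refine ⟨fun x => max (-M) (min M (w x)), M, measurable_const.max (measurable_const.min hw),
    fun x => abs_le.2 ⟨le_max_left _ _, max_le (by linarith) (min_le_left _ _)⟩, ?_⟩
  have h1 : ∀ᵐ x ∂μ, ‖u x‖ₑ ≤ eLpNorm u ⊤ μ := by
    rw [eLpNorm_exponent_top]; exact ae_le_eLpNormEssSup
  filter_upwards [huw, h1] with x hx hx1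
  have h2 : |u x| ≤ M := by
    have := ENNReal.toReal_mono hu.2.ne hx1
    rwa [toReal_enorm, Real.norm_eq_abs] at this
  have h3 := abs_le.1 h2
  rw [← hx, min_eq_right h3.2, max_eq_right h3.1]

end Congruence

/-! ### Essential infima and the regularization. -/

section Regularization

variable {n : ℕ}

local notation "E" => EuclideanSpace ℝ (Fin n)

/-- The real-valued essential infimum is meaningful only under boundedness: the almost everywhere
upper bound and the positive measure of the ball exclude default values. -/
theorem le_essInfBall {u : E → ℝ} {M c r : ℝ} (hu : ∀ᵐ y, |u y| ≤ M) {x : E} (hr : 0 < r)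
    (hc : ∀ᵐ y ∂volume.restrict (ball x r), c ≤ u y) : c ≤ essInfBall u x r := by
  have : (ae (volume.restrict (ball x r))).NeBot := by
    rw [ae_neBot, Ne, Measure.restrict_eq_zero]
    exact (measure_ball_pos volume x hr).ne'
  refine le_liminf_of_le ?_ hc
  have hb : IsBoundedUnder (· ≤ ·) (ae (volume.restrict (ball x r))) u :=
    isBoundedUnder_of_eventually_le (a := M)
      ((ae_restrict_of_ae hu).mono fun _ hy => (abs_le.1 hy).2)
  exact hb.isCoboundedUnder_ge

theorem ae_lt_of_lt_essInfBall {u : E → ℝ} {M c r : ℝ} (hu : ∀ᵐ y, |u y| ≤ M) {x : E}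
    (hc : c < essInfBall u x r) : ∀ᵐ y ∂volume.restrict (ball x r), c < u y :=
  ae_lt_of_lt_essInf hc (isBoundedUnder_of_eventually_ge (a := -M)
    ((ae_restrict_of_ae hu).mono fun _ hy => (abs_le.1 hy).1))

theorem essInfBall_mono {u : E → ℝ} {M : ℝ} (hu : ∀ᵐ y, |u y| ≤ M) {x y : E} {r r' : ℝ}
    (hr' : 0 < r') (hsub : ball y r' ⊆ ball x r) : essInfBall u x r ≤ essInfBall u y r' := by
  refine le_of_forall_lt fun c hc => ?_
  obtain ⟨c', hcc', hc'⟩ := exists_between hc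
  have h : ∀ᵐ z ∂volume.restrict (ball y r'), c' < u z :=
    ae_mono (Measure.restrict_mono hsub le_rfl) (ae_lt_of_lt_essInfBall hu hc')
  exact hcc'.trans_le (le_essInfBall hu hr' (h.mono fun _ h => le_of_lt h))

theorem essInfBall_le {u : E → ℝ} {M : ℝ} (hu : ∀ᵐ y, |u y| ≤ M) {x : E} {r : ℝ} (hr : 0 < r) :
    essInfBall u x r ≤ M := by
  by_contra! h
  have h1 := ae_lt_of_lt_essInfBall hu h
  have : (ae (volume.restrict (ball x r))).NeBot := by
    rw [ae_neBot, Ne, Measure.restrict_eq_zero]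
    exact (measure_ball_pos volume x hr).ne'
  obtain ⟨y, hy1, hy2⟩ := (h1.and (ae_restrict_of_ae hu)).exists
  linarith [(abs_le.1 hy2).2]

/-- The essential infima over shrinking balls increase to the regularization. -/
theorem tendsto_essInfBall {u : E → ℝ} {M : ℝ} (hu : ∀ᵐ y, |u y| ≤ M) (x : E) :
    Tendsto (essInfBall u x) (𝓝[>] 0) (𝓝 (lscReg u x)) ∧
      (∀ r, 0 < r → essInfBall u x r ≤ lscReg u x) ∧
      ∀ c < lscReg u x, ∃ r, 0 < r ∧ c < essInfBall u x r := by
  set S := essInfBall u x '' Ioi 0 with hS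
  have hbdd : BddAbove S := by
    refine ⟨M, ?_⟩
    rintro _ ⟨r, hr, rfl⟩
    exact essInfBall_le hu hr
  have hne : S.Nonempty := ⟨_, 1, one_pos (α := ℝ), rfl⟩
  have hle : ∀ r, 0 < r → essInfBall u x r ≤ sSup S := fun r hr => le_csSup hbdd ⟨r, hr, rfl⟩
  have hex : ∀ c < sSup S, ∃ r, 0 < r ∧ c < essInfBall u x r := by
    intro c hc
    obtain ⟨_, ⟨r, hr, rfl⟩, h⟩ := exists_lt_of_lt_csSup hne hc
    exact ⟨r, hr, h⟩
  have hlim : Tendsto (essInfBall u x) (𝓝[>] 0) (𝓝 (sSup S)) := by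
    refine tendsto_order.2 ⟨fun c hc => ?_, fun c hc => ?_⟩
    · obtain ⟨r, hr, h⟩ := hex c hc
      filter_upwards [Ioo_mem_nhdsGT hr] with t ht
      exact h.trans_le (essInfBall_mono hu ht.1 (ball_subset_ball ht.2.le))
    · filter_upwards [self_mem_nhdsWithin] with t ht
      exact (hle t ht).trans_lt hc
  have : lscReg u x = sSup S := hlim.limUnder_eq
  rw [this]
  exact ⟨hlim, hle, hex⟩

/-- A small ball around a nearby point fits into `ball x r`, where the essential infimum already
exceeds `c`. -/
theorem lowerSemicontinuous_lscReg {u : E → ℝ} {M : ℝ} (hu : ∀ᵐ y, |u y| ≤ M) :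
    LowerSemicontinuous (lscReg u) := by
  intro x c hc
  obtain ⟨r, hr, h⟩ := (tendsto_essInfBall hu x).2.2 c hc
  filter_upwards [ball_mem_nhds x hr] with y hy
  have hpos : 0 < r - dist y x := sub_pos.2 hy
  exact (h.trans_le (essInfBall_mono hu hpos
    (ball_subset_ball' (by linarith)))).trans_le ((tendsto_essInfBall hu y).2.1 _ hpos)

theorem integrable_abs_const_sub {α : Type*} [MeasurableSpace α] {μ : Measure α}
    [IsFiniteMeasure μ] {u : α → ℝ} (hum : AEStronglyMeasurable u μ) {M : ℝ}
    (hu : ∀ᵐ y ∂μ, |u y| ≤ M) (c : ℝ) : Integrable (fun y => |c - u y|) μ :=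
  ((integrable_const c).sub (Integrable.of_bound hum M hu)).abs

/-- Otherwise `u > c > u x` almost everywhere in small balls, which keeps the means of `|u x - u|`
above `c - u x > 0`. -/
theorem lscReg_le_of_mem_lebesguePoints {Ω : Opens E} {u : E → ℝ} {M : ℝ}
    (hum : AEStronglyMeasurable u volume) (hu : ∀ᵐ y, |u y| ≤ M) {x : E}
    (hx : x ∈ lebesguePoints Ω u) : lscReg u x ≤ u x := by
  by_contra! h
  obtain ⟨c, hc1, hc2⟩ := exists_between h
  obtain ⟨r₀, hr₀, hr⟩ := (tendsto_essInfBall hu x).2.2 c hc2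
  have hev : ∀ᶠ r in 𝓝[>] (0 : ℝ), c - u x ≤ ⨍ y in ball x r, |u x - u y| := by
    filter_upwards [Ioo_mem_nhdsGT hr₀] with r hrr
    have hpos : 0 < volume.real (ball x r) :=
      ENNReal.toReal_pos (measure_ball_pos volume x hrr.1).ne' measure_ball_lt_top.ne
    have : IsFiniteMeasure (volume.restrict (ball x r)) := ⟨by simpa using measure_ball_lt_top⟩
    rw [setAverage_eq, smul_eq_mul, ← div_eq_inv_mul, le_div_iff₀ hpos]
    have h1 : ∫ _ in ball x r, (c - u x) = (c - u x) * volume.real (ball x r) := by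
      rw [setIntegral_const, smul_eq_mul, mul_comm]
    rw [← h1]
    refine integral_mono_ae (integrable_const _)
      (integrable_abs_const_sub hum.restrict (ae_restrict_of_ae hu) _) ?_
    filter_upwards [ae_mono (Measure.restrict_mono (ball_subset_ball hrr.2.le) le_rfl)
      (ae_lt_of_lt_essInfBall hu hr)] with y hy
    rw [abs_sub_comm]
    exact le_trans (by linarith) (le_abs_self _)
  have := ge_of_tendsto hx.2 hev
  linarith

/-- Lebesgue differentiation along the Besicovitch family concerns closed balls; spheres are null
because `n ≥ 1`, so open balls give the same means. -/
theorem ae_mem_lebesguePoints (hn : 1 ≤ n) (Ω : Opens E) {u : E → ℝ} (hu : LocallyIntegrable u) :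
    ∀ᵐ x ∂volume.restrict (Ω : Set E), x ∈ lebesguePoints Ω u := by
  have : Nontrivial E := Module.nontrivial_of_finrank_pos (R := ℝ) (by
    rw [finrank_euclideanSpace_fin]; exact hn)
  filter_upwards [ae_restrict_of_ae
    ((Besicovitch.vitaliFamily (volume : Measure E)).ae_tendsto_average_norm_sub hu),
    ae_restrict_mem Ω.isOpen.measurableSet] with x hx hxΩ
  refine ⟨hxΩ, (hx.comp (Besicovitch.tendsto_filterAt volume x)).congr' ?_⟩
  filter_upwards [self_mem_nhdsWithin] with r hr
  have hae : closedBall x r =ᵐ[volume] ball x r :=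
    (ae_eq_of_subset_of_measure_ge ball_subset_closedBall
      (Measure.addHaar_closedBall_eq_addHaar_ball volume x r).le
      measurableSet_ball.nullMeasurableSet measure_closedBall_lt_top.ne).symm
  simp only [Function.comp_apply, Real.norm_eq_abs]
  rw [setAverage_congr hae]
  simp only [abs_sub_comm]

end Regularization

/-! ### De Giorgi's lemma at Lebesgue points. -/

section LebesguePoints

variable {n : ℕ}

local notation "E" => EuclideanSpace ℝ (Fin n)

/-- A supersolution is at most its regularization at Lebesgue points. -/
theorem IsWeakSupersolution.le_lscReg (hn : 1 ≤ n) {p s L : ℝ} (hp : 1 < p) (hs0 : 0 < s)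
    (hs1 : s < 1) (hL : 1 ≤ L) {K : E → E → ℝ} (hK : IsKernel p s L K) {Ω : Opens E}
    {u : E → ℝ} (hsup : IsWeakSupersolution p K Ω u) {x : E} (hx : x ∈ lebesguePoints Ω u) :
    u x ≤ lscReg u x := by
  obtain ⟨v, M, hvm, hvM, huv⟩ := exists_measurable_bounded_ae_eq hsup.memLp_top
  have hu : ∀ᵐ y, |u y| ≤ M := huv.mono fun y hy => by rw [hy]; exact hvM y
  by_contra! h
  set T := lscReg u x with hT
  -- With a third of the gap, the final level `k - d = u x - 2d` is still `d` above the
  -- regularization.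
  set d := (u x - T) / 3 with hd
  have hd0 : 0 < d := by rw [hd]; linarith
  set k := u x - d with hk
  have hkd : T < k - d := by rw [hk, hd]; linarith
  set M' := |M| + |k| + |k - d| with hM'
  have hvM' : ∀ y, |v y| ≤ M' := fun y => by
    have := (hvM y).trans (le_abs_self M)
    rw [hM']; linarith [abs_nonneg k, abs_nonneg (k - d)]
  obtain ⟨ν, hν0, hν⟩ := exists_deGiorgi hn hp hs0 hs1 hL hK (M := M') (k := k) (d := d)
    (by rw [hM']; linarith [abs_nonneg M, abs_nonneg (k - d)]) hd0
    (by rw [hM']; linarith [abs_nonneg M, abs_nonneg k])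
  obtain ⟨ρ, hρ0, hρ⟩ := nhds_basis_closedBall.mem_iff.1 (Ω.isOpen.mem_nhds hx.1)
  set ω := volume.real (ball (0 : E) 1) with hω
  have hω0 : 0 < ω :=
    ENNReal.toReal_pos (measure_ball_pos volume _ one_pos).ne' measure_ball_lt_top.ne
  -- Since `ν` was fixed before `r`, the radius can be chosen so that Chebyshev's inequality puts
  -- the density of `{v < k}` below the threshold.
  have hev : ∀ᶠ r in 𝓝[>] (0 : ℝ), ⨍ y in ball x r, |u x - u y| < ν * d / ω :=
    hx.2.eventually (gt_mem_nhds (by positivity))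
  obtain ⟨r, hr, hr0, hr1⟩ := (hev.and (Ioo_mem_nhdsGT (lt_min hρ0 one_pos))).exists
  have hvol : volume.real (ball x r) = r ^ n * ω := by
    rw [measureReal_def, Measure.addHaar_ball_of_pos volume x hr0, ENNReal.toReal_mul,
      ENNReal.toReal_ofReal (by positivity)]
    simp [hω, measureReal_def]
  have hpos : 0 < volume.real (ball x r) := by rw [hvol]; positivity
  have hfin : IsFiniteMeasure (volume.restrict (ball x r)) := ⟨by simpa using measure_ball_lt_top⟩
  have hBm : MeasurableSet ({y | v y < k} ∩ ball x r) :=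
    (measurableSet_lt hvm measurable_const).inter measurableSet_ball
  have hBf : volume ({y | v y < k} ∩ ball x r) ≠ ∞ :=
    ((measure_mono inter_subset_right).trans_lt measure_ball_lt_top).ne
  have hcheb : d * volume.real ({y | v y < k} ∩ ball x r) ≤ ∫ y in ball x r, |u x - u y| := by
    have h1 : ∫ y in ball x r, ({y | v y < k} ∩ ball x r).indicator (fun _ => d) y =
        d * volume.real ({y | v y < k} ∩ ball x r) := by
      rw [integral_indicator_const _ hBm, smul_eq_mul, measureReal_restrict_apply hBm,
        inter_eq_self_of_subset_left inter_subset_right, mul_comm]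
    rw [← h1]
    refine integral_mono_ae
      ((integrable_indicator_iff hBm).2 (integrableOn_const hBf)).restrict
      (integrable_abs_const_sub hsup.memLp_top.1.restrict (ae_restrict_of_ae hu) _) ?_
    filter_upwards [ae_restrict_of_ae huv] with y hy
    by_cases hyB : y ∈ {y | v y < k} ∩ ball x r
    · rw [indicator_of_mem hyB]
      have hyk : v y < k := hyB.1
      rw [← hy] at hyk
      exact le_trans (by linarith) (le_abs_self _)
    · rw [indicator_of_notMem hyB]; exact abs_nonneg _
  have hsmall : volume.real ({y | v y < k} ∩ ball x r) ≤ ν * r ^ n := by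
    rw [setAverage_eq, smul_eq_mul, ← div_eq_inv_mul, div_lt_div_iff₀ hpos hω0, hvol] at hr
    have h2 := mul_le_mul_of_nonneg_right hcheb hω0.le
    have h3 : d * ω * volume.real ({y | v y < k} ∩ ball x r) ≤ d * ω * (ν * r ^ n) := by
      linarith
    exact le_of_mul_le_mul_left h3 (by positivity)
  have hnull := hν Ω v hvm hvM' (hsup.congr huv) x r ρ hr0 (hr1.le.trans (min_le_right _ _))
    (hr1.trans_le (min_le_left _ _)) hρ hsmall
  have hge : ∀ᵐ y ∂volume.restrict (ball x (r / 2)), k - d ≤ u y := by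
    rw [ae_restrict_iff' measurableSet_ball]
    filter_upwards [huv, compl_mem_ae_iff.2 hnull] with y hy hy2 hyb
    rw [hy]
    by_contra! hlt
    exact hy2 ⟨hlt, hyb⟩
  have h1 := le_essInfBall hu (half_pos hr0) hge
  have h2 := (tendsto_essInfBall hu x).2.1 _ (half_pos hr0)
  linarith

end LebesguePoints
end MixedPLaplace

theorem theorem9p2 (n : ℕ) (hn : 1 ≤ n) (p s L : ℝ) (hp : 1 < p) (hs0 : 0 < s) (hs1 : s < 1)
    (hL : 1 ≤ L) (K : EuclideanSpace ℝ (Fin n) → EuclideanSpace ℝ (Fin n) → ℝ)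
    (hK : MixedPLaplace.IsKernel p s L K)
    (Ω : Opens (EuclideanSpace ℝ (Fin n)))
    (hΩ : IsConnected (Ω : Set (EuclideanSpace ℝ (Fin n))))
    (hΩb : Bornology.IsBounded (Ω : Set (EuclideanSpace ℝ (Fin n))))
    (u : EuclideanSpace ℝ (Fin n) → ℝ) (hu : MixedPLaplace.IsWeakSupersolution p K Ω u) :
    (∀ x ∈ Ω, Tendsto (MixedPLaplace.essInfBall u x) (𝓝[>] 0)
      (𝓝 (MixedPLaplace.lscReg u x))) ∧
    (∀ x ∈ MixedPLaplace.lebesguePoints Ω u, u x = MixedPLaplace.lscReg u x) ∧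
    LowerSemicontinuousOn (MixedPLaplace.lscReg u) Ω ∧
    MixedPLaplace.lscReg u =ᵐ[volume.restrict Ω] u := by
  have hbdd : ∃ M : ℝ, ∀ᵐ y, |u y| ≤ M := by
    obtain ⟨v, M, -, hvM, huv⟩ := MixedPLaplace.exists_measurable_bounded_ae_eq hu.memLp_top
    exact ⟨M, huv.mono fun y hy => by rw [hy]; exact hvM y⟩
  obtain ⟨M, hM⟩ := hbdd
  have hpts : ∀ x ∈ MixedPLaplace.lebesguePoints Ω u, u x = MixedPLaplace.lscReg u x :=
    fun x hx => le_antisymm (hu.le_lscReg hn hp hs0 hs1 hL hK hx)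
      (MixedPLaplace.lscReg_le_of_mem_lebesguePoints hu.memLp_top.1 hM hx)
  refine ⟨fun x _ => (MixedPLaplace.tendsto_essInfBall hM x).1, hpts,
    (MixedPLaplace.lowerSemicontinuous_lscReg hM).lowerSemicontinuousOn _, ?_⟩
  filter_upwards [MixedPLaplace.ae_mem_lebesguePoints hn Ω
    (hu.memLp_top.locallyIntegrable le_top)] with x hx
  exact (hpts x hx).symm
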